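/- Let $\mathcal{A}$ be an abelian category and $\mathcal{E}\subseteq\mathcal{A}$ a full subcategory. Call $\mathcal{E}$ *resolving* if (R0) $\mathcal{E}$ is closed under retracts; (R1) for every short exact sequence $0\to X\to Y\to Z\to 0$ in $\mathcal{A}$ with $Z\in\mathcal{E}$ one has $X\in\mathcal{E}$ if and only if $Y\in\mathcal{E}$; (R2) for every $A\in\mathcal{A}$ there is an epimorphism $X\to A$ with $X\in\mathcal{E}$. Call $\mathcal{E}$ *functorially resolving* if, moreover, the epimorphisms in (R2) can be chosen functorially in $A$, i.e. there are a functor $F\colon\mathcal{A}\to\mathcal{A}$ with values in $\mathcal{E}$ and a natural transformation $\pi\colon F\to\mathrm{id}_{\mathcal{A}}$ all of whose components are epimorphisms. The *$\mathcal{E}$-resolution dimension* of $A\in\mathcal{A}$ is the least integer $n\ge 0$ for which there is an exact sequence $0\to X_n\to\cdots\to X_1\to X_0\to A\to 0$ with $X_0,\dots,X_n\in\mathcal{E}$, and $\infty$ if there is none. A resolving subcategory $\mathcal{E}$ is closed under extensions, hence is an exact category (in the sense of Quillen) whose conflations are the short exact sequences of $\mathcal{A}$ with all terms in $\mathcal{E}$.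 For an exact category $\mathcal{E}$, a complex $X$ over $\mathcal{E}$ is *acyclic* if its differentials factor as $X^k\to Z^{k+1}\to X^{k+1}$ so that all $Z^k\to X^k\to Z^{k+1}$ are conflations, and the (unbounded) derived category $\mathbf{D}(\mathcal{E})$ is the Verdier quotient of the homotopy category $\mathbf{K}(\mathcal{E})$ of complexes by the acyclic complexes. $\mathbf{D}(\mathcal{A})$ denotes the unbounded derived category of $\mathcal{A}$. For a small category $I$ the diagram category $\mathcal{E}^I$ is an exact category with componentwise conflations, and $\mathcal{A}^I$ is abelian. A *prederivator* is a strict $2$-functor from the $2$-category of small categories, with $1$-morphisms reversed and $2$-morphisms kept, to the $2$-category of (not necessarily small) categories; a morphism of prederivators is a pseudonatural transformation; it is an *equivalence* if each of its components is an equivalence of categories. The prederivators $\mathbb{D}_{\mathcal{E}}$ and $\mathbb{D}_{\mathcal{A}}$ are given by $\mathbb{D}_{\mathcal{E}}(I)=\mathbf{D}(\mathcal{E}^I)$ and $\mathbb{D}_{\mathcal{A}}(I)=\mathbf{D}(\mathcal{A}^I)$, with the functors $u^*$ and the natural transformations $\alpha^*$ induced by restriction of diagrams. The inclusion $\mathcal{E}\subseteq\mathcal{A}$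 induces a functor $\mathbf{D}(\mathcal{E})\to\mathbf{D}(\mathcal{A})$ and a morphism of prederivators $F\colon\mathbb{D}_{\mathcal{E}}\to\mathbb{D}_{\mathcal{A}}$ whose component $F_I$ is the functor $\mathbf{D}(\mathcal{E}^I)\to\mathbf{D}(\mathcal{A}^I)$ induced by the inclusion $\mathcal{E}^I\subseteq\mathcal{A}^I$, and whose structure isomorphisms $u^*F_J\cong F_Iu^*$ are identities. **Proposition.** Let $\mathcal{A}$ be an abelian category and $\mathcal{E}\subseteq\mathcal{A}$ a resolving full subcategory such that, for some integer $n\ge 0$, every object of $\mathcal{A}$ has $\mathcal{E}$-resolution dimension at most $n$. Then the induced functor $\mathbf{D}(\mathcal{E})\to\mathbf{D}(\mathcal{A})$ is a triangle equivalence. If, moreover, $\mathcal{E}$ is functorially resolving in $\mathcal{A}$, then the induced morphism of prederivators $F\colon\mathbb{D}_{\mathcal{E}}\to\mathbb{D}_{\mathcal{A}}$ is an equivalence. -/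

import Mathlib

open CategoryTheory Limits Bicategory

universe w' w v u v' u' w₂ v₂ u₂

namespace CategoryTheory

/-! ### Exact categories -/

section ConflationClass

variable {E : Type u} [Category.{v} E] [HasZeroMorphisms E]

/-- The morphisms `i` which occur as first map of a short complex `X --i--> Y --d--> Z`
of a given class. -/
def ObjectProperty.firstMaps (c : ObjectProperty (ShortComplex E)) : MorphismProperty E :=
  fun _ Y i => ∃ (Z : E) (d : Y ⟶ Z) (w : i ≫ d = 0), c (ShortComplex.mk i d w)

/-- The morphisms `d` which occur as second map of a short complex `X --i--> Y --d--> Z`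
of a given class. -/
def ObjectProperty.secondMaps (c : ObjectProperty (ShortComplex E)) : MorphismProperty E :=
  fun Y _ d => ∃ (X : E) (i : X ⟶ Y) (w : i ≫ d = 0), c (ShortComplex.mk i d w)

end ConflationClass

/-- A (Quillen) exact category: an additive category with a class of kernel-cokernel pairs,
the conflations, satisfying Quillen's axioms. The first maps of conflations
are the inflations, the second maps are the deflations. -/
class ExactCategory (E : Type u) [Category.{v} E] [Preadditive E] [HasZeroObject E]
    [HasBinaryBiproducts E] where
  /-- the class of conflations -/
  conflation : ObjectProperty (ShortComplex E)
  closedUnderIso : conflation.IsClosedUnderIsomorphisms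
  isKernel (S : ShortComplex E) (hS : conflation S) :
    Nonempty (IsLimit (KernelFork.ofι S.f S.zero))
  isCokernel (S : ShortComplex E) (hS : conflation S) :
    Nonempty (IsColimit (CokernelCofork.ofπ S.g S.zero))
  id_inflation (X : E) : conflation.firstMaps (𝟙 X)
  id_deflation (X : E) : conflation.secondMaps (𝟙 X)
  comp_inflation {X Y Z : E} (f : X ⟶ Y) (g : Y ⟶ Z) :
    conflation.firstMaps f → conflation.firstMaps g → conflation.firstMaps (f ≫ g)
  comp_deflation {X Y Z : E} (f : X ⟶ Y) (g : Y ⟶ Z) :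
    conflation.secondMaps f → conflation.secondMaps g → conflation.secondMaps (f ≫ g)
  /-- inflations have pushouts along arbitrary morphisms, and these are inflations -/
  pushout_inflation {X Y X' : E} (i : X ⟶ Y) (f : X ⟶ X') (hi : conflation.firstMaps i) :
    ∃ (Y' : E) (f' : Y ⟶ Y') (i' : X' ⟶ Y'), IsPushout i f f' i' ∧ conflation.firstMaps i'
  /-- deflations have pullbacks along arbitrary morphisms, and these are deflations -/
  pullback_deflation {Y Z Z' : E} (d : Y ⟶ Z) (f : Z' ⟶ Z) (hd : conflation.secondMaps d) :
    ∃ (Y' : E) (f' : Y' ⟶ Y) (d' : Y' ⟶ Z'), IsPullback f' d' d f ∧ conflation.secondMaps d'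

/-! ### Extension closed subcategories of abelian categories are exact categories -/

namespace ObjectProperty

variable {A : Type u} [Category.{v} A] [Abelian A] (P : ObjectProperty A)

instance hasBinaryBiproducts_fullSubcategory [P.IsClosedUnderExtensions] :
    HasBinaryBiproducts P.FullSubcategory where
  has_binary_biproduct X Y :=
    hasBinaryBiproduct_of_total
      { pt := ⟨X.obj ⊞ Y.obj, P.prop_biprod X.property Y.property⟩
        fst := homMk biprod.fst
        snd := homMk biprod.snd
        inl := homMk biprod.inl
        inr := homMk biprod.inr
        inl_fst := by ext; exact biprod.inl_fst
        inl_snd := by ext; exact biprod.inl_snd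
        inr_fst := by ext; exact biprod.inr_fst
        inr_snd := by ext; exact biprod.inr_snd }
      (by apply P.hom_ext; exact biprod.total (X := X.obj) (Y := Y.obj))

/-- The short complexes in a full subcategory of an abelian category which are
short exact in the ambient abelian category. -/
def inducedConflation : ObjectProperty (ShortComplex P.FullSubcategory) :=
  fun S => (S.map P.ι).ShortExact

variable {P}

lemma inducedConflation_firstMaps_iff [P.IsClosedUnderIsomorphisms] {X Y : P.FullSubcategory}
    (f : X ⟶ Y) :
    P.inducedConflation.firstMaps f ↔ Mono f.hom ∧ P (cokernel f.hom) := by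
  constructor
  · rintro ⟨Z, d, w, h⟩
    refine ⟨h.mono_f, P.prop_of_iso ?_ Z.property⟩
    exact (IsColimit.coconePointUniqueUpToIso (cokernelIsCokernel f.hom) h.gIsCokernel).symm
  · rintro ⟨h₁, h₂⟩
    refine ⟨⟨_, h₂⟩, homMk (cokernel.π f.hom), by ext; exact cokernel.condition _, ?_⟩
    exact
      { exact := ShortComplex.exact_of_g_is_cokernel _ (cokernelIsCokernel f.hom)
        mono_f := h₁
        epi_g := inferInstanceAs (Epi (cokernel.π f.hom)) }

lemma inducedConflation_secondMaps_iff [P.IsClosedUnderIsomorphisms] {X Y : P.FullSubcategory}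
    (f : X ⟶ Y) :
    P.inducedConflation.secondMaps f ↔ Epi f.hom ∧ P (kernel f.hom) := by
  constructor
  · rintro ⟨Z, d, w, h⟩
    refine ⟨h.epi_g, P.prop_of_iso ?_ Z.property⟩
    exact (IsLimit.conePointUniqueUpToIso (kernelIsKernel f.hom) h.fIsKernel).symm
  · rintro ⟨h₁, h₂⟩
    refine ⟨⟨_, h₂⟩, homMk (kernel.ι f.hom), by ext; exact kernel.condition _, ?_⟩
    exact
      { exact := ShortComplex.exact_of_f_is_kernel _ (kernelIsKernel f.hom)
        mono_f := inferInstanceAs (Mono (kernel.ι f.hom))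
        epi_g := h₁ }

variable (P)

/-- An extension closed subcategory `E` of an abelian category `A` is an exact category, the
conflations being the short exact sequences of `A` all of whose terms belong to `E`. -/
instance exactCategoryFullSubcategory [P.ContainsZero] [P.IsClosedUnderIsomorphisms]
    [P.IsClosedUnderExtensions] : ExactCategory P.FullSubcategory where
  conflation := P.inducedConflation
  closedUnderIso :=
    { of_iso := fun {S T} e hS =>
        ShortComplex.shortExact_of_iso (P.ι.mapShortComplex.mapIso e) hS }
  isKernel S hS :=
    ⟨KernelFork.IsLimit.ofι _ _
      (fun k hk => homMk (hS.fIsKernel.lift (KernelFork.ofι k.hom (P.ι.congr_map hk))))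
      (fun k hk => by
        ext; exact hS.fIsKernel.fac (KernelFork.ofι k.hom (P.ι.congr_map hk)) .zero)
      (fun k hk m hm => by
        ext
        apply Fork.IsLimit.hom_ext hS.fIsKernel
        exact (P.ι.congr_map hm).trans
          (hS.fIsKernel.fac (KernelFork.ofι k.hom (P.ι.congr_map hk)) .zero).symm)⟩
  isCokernel S hS :=
    ⟨CokernelCofork.IsColimit.ofπ _ _
      (fun k hk => homMk (hS.gIsCokernel.desc (CokernelCofork.ofπ k.hom (P.ι.congr_map hk))))
      (fun k hk => by
        ext; exact hS.gIsCokernel.fac (CokernelCofork.ofπ k.hom (P.ι.congr_map hk)) .one)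
      (fun k hk m hm => by
        ext
        apply Cofork.IsColimit.hom_ext hS.gIsCokernel
        exact (P.ι.congr_map hm).trans
          (hS.gIsCokernel.fac (CokernelCofork.ofπ k.hom (P.ι.congr_map hk)) .one).symm)⟩
  id_inflation X := by
    rw [inducedConflation_firstMaps_iff]
    exact ⟨inferInstanceAs (Mono (𝟙 X.obj)), P.prop_of_isZero (isZero_cokernel_of_epi (𝟙 X.obj))⟩
  id_deflation X := by
    rw [inducedConflation_secondMaps_iff]
    exact ⟨inferInstanceAs (Epi (𝟙 X.obj)), P.prop_of_isZero (isZero_kernel_of_mono (𝟙 X.obj))⟩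
  comp_inflation f g hf hg := by
    rw [inducedConflation_firstMaps_iff] at hf hg ⊢
    obtain ⟨_, hf⟩ := hf
    obtain ⟨_, hg⟩ := hg
    refine ⟨mono_comp f.hom g.hom, ?_⟩
    have h := kernelCokernelCompSequence_exact f.hom g.hom
    have h0 : IsZero (kernel g.hom) := isZero_kernel_of_mono _
    have h1 : Epi ((kernelCokernelCompSequence f.hom g.hom).map' 4 5) := inferInstance
    exact P.prop_X₂_of_shortExact
      { exact := h.exact 3
        mono_f := (h.exact 2).mono_g (h0.eq_of_src _ _)
        epi_g := h1 } hf hg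
  comp_deflation f g hf hg := by
    rw [inducedConflation_secondMaps_iff] at hf hg ⊢
    obtain ⟨_, hf⟩ := hf
    obtain ⟨_, hg⟩ := hg
    refine ⟨epi_comp f.hom g.hom, ?_⟩
    have h := kernelCokernelCompSequence_exact f.hom g.hom
    have h0 : IsZero (cokernel f.hom) := isZero_cokernel_of_epi _
    have h1 : Mono ((kernelCokernelCompSequence f.hom g.hom).map' 0 1) := inferInstance
    exact P.prop_X₂_of_shortExact
      { exact := h.exact 0
        mono_f := h1
        epi_g := (h.exact 1).epi_f (h0.eq_of_tgt _ _) } hf hg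
  pushout_inflation {X Y X'} i f hi := by
    rw [inducedConflation_firstMaps_iff] at hi
    obtain ⟨_, hi⟩ := hi
    have sq := IsPushout.of_hasPushout i.hom f.hom
    have := isIso_cokernel_map_of_isPushout sq
    have hc : P (cokernel (pushout.inr i.hom f.hom)) :=
      P.prop_of_iso (asIso (cokernel.map _ _ _ _ sq.w)) hi
    have hY' : P (pushout i.hom f.hom) :=
      P.prop_X₂_of_shortExact (S := ShortComplex.mk (pushout.inr i.hom f.hom)
        (cokernel.π _) (cokernel.condition _))
        { exact := ShortComplex.exact_of_g_is_cokernel _ (cokernelIsCokernel _)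
          mono_f := inferInstance
          epi_g := inferInstance } X'.property hc
    refine ⟨⟨_, hY'⟩, homMk (pushout.inl i.hom f.hom), homMk (pushout.inr i.hom f.hom),
      IsPushout.of_map_of_faithful P.ι sq, ?_⟩
    rw [inducedConflation_firstMaps_iff]
    exact ⟨inferInstanceAs (Mono (pushout.inr i.hom f.hom)), hc⟩
  pullback_deflation {Y Z Z'} d f hd := by
    rw [inducedConflation_secondMaps_iff] at hd
    obtain ⟨_, hd⟩ := hd
    have sq := IsPullback.of_hasPullback d.hom f.hom
    have := isIso_kernel_map_of_isPullback sq.flip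
    have hc : P (kernel (pullback.snd d.hom f.hom)) :=
      P.prop_of_iso (asIso (kernel.map _ _ _ _ sq.w.symm)).symm hd
    have hY' : P (pullback d.hom f.hom) :=
      P.prop_X₂_of_shortExact (S := ShortComplex.mk (kernel.ι _)
        (pullback.snd d.hom f.hom) (kernel.condition _))
        { exact := ShortComplex.exact_of_f_is_kernel _ (kernelIsKernel _)
          mono_f := inferInstance
          epi_g := inferInstance } hc Z'.property
    refine ⟨⟨_, hY'⟩, homMk (pullback.fst d.hom f.hom), homMk (pullback.snd d.hom f.hom),
      IsPullback.of_map_of_faithful P.ι sq, ?_⟩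
    rw [inducedConflation_secondMaps_iff]
    exact ⟨inferInstanceAs (Epi (pullback.snd d.hom f.hom)), hc⟩

end ObjectProperty

/-! ### Diagrams in an exact category form an exact category -/

namespace ExactCategory

variable (I : Type w) [Category.{w'} I]
  {E : Type u} [Category.{v} E] [Preadditive E] [HasZeroObject E] [HasBinaryBiproducts E]
  [ExactCategory E]

section

variable {S : ShortComplex E}

lemma exists_lift_of_conflation (hS : conflation S) {W : E} (k : W ⟶ S.X₂) (hk : k ≫ S.g = 0) :
    ∃ l : W ⟶ S.X₁, l ≫ S.f = k :=
  ⟨(isKernel S hS).some.lift (KernelFork.ofι k hk),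
    (isKernel S hS).some.fac (KernelFork.ofι k hk) .zero⟩

lemma exists_desc_of_conflation (hS : conflation S) {W : E} (k : S.X₂ ⟶ W) (hk : S.f ≫ k = 0) :
    ∃ l : S.X₃ ⟶ W, S.g ≫ l = k :=
  ⟨(isCokernel S hS).some.desc (CokernelCofork.ofπ k hk),
    (isCokernel S hS).some.fac (CokernelCofork.ofπ k hk) .one⟩

lemma mono_of_conflation (hS : conflation S) : Mono S.f :=
  ⟨fun _ _ h => Fork.IsLimit.hom_ext (isKernel S hS).some h⟩

lemma epi_of_conflation (hS : conflation S) : Epi S.g :=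
  ⟨fun _ _ h => Cofork.IsColimit.hom_ext (isCokernel S hS).some h⟩

end

variable (E) in
/-- The componentwise conflations in a category of diagrams. -/
def diagramConflation : ObjectProperty (ShortComplex (I ⥤ E)) :=
  fun S => ∀ i : I, conflation (S.map ((evaluation I E).obj i))

variable {I}

lemma diagramConflation_firstMaps_iff {X Y : I ⥤ E} (f : X ⟶ Y) :
    (diagramConflation I E).firstMaps f ↔ ∀ i, (conflation (E := E)).firstMaps (f.app i) := by
  constructor
  · rintro ⟨Z, d, w, h⟩ i
    exact ⟨Z.obj i, d.app i, congr_app w i, h i⟩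
  · intro h
    choose Z d w h using h
    have hd (i : I) : Epi (d i) := epi_of_conflation (h i)
    have ex {i j : I} (φ : i ⟶ j) : ∃ l : Z i ⟶ Z j, d i ≫ l = Y.map φ ≫ d j :=
      exists_desc_of_conflation (h i) (Y.map φ ≫ d j) (by
        dsimp
        rw [← NatTrans.naturality_assoc, w, comp_zero])
    choose m hm using @ex
    let Z' : I ⥤ E :=
      { obj := Z
        map := fun φ => m φ
        map_id := fun i => by rw [← cancel_epi (d i), hm]; simp
        map_comp := fun φ ψ => by rw [← cancel_epi (d _), hm, reassoc_of% hm, hm]; simp }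
    exact ⟨Z', { app := d, naturality := fun i j φ => (hm φ).symm }, by ext i; exact w i, h⟩

lemma diagramConflation_secondMaps_iff {X Y : I ⥤ E} (f : X ⟶ Y) :
    (diagramConflation I E).secondMaps f ↔ ∀ i, (conflation (E := E)).secondMaps (f.app i) := by
  constructor
  · rintro ⟨Z, d, w, h⟩ i
    exact ⟨Z.obj i, d.app i, congr_app w i, h i⟩
  · intro h
    choose Z d w h using h
    have hd (i : I) : Mono (d i) := mono_of_conflation (h i)
    have ex {i j : I} (φ : i ⟶ j) : ∃ l : Z i ⟶ Z j, l ≫ d j = d i ≫ X.map φ :=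
      exists_lift_of_conflation (h j) (d i ≫ X.map φ) (by
        dsimp
        rw [Category.assoc, NatTrans.naturality, reassoc_of% (w i), zero_comp])
    choose m hm using @ex
    let Z' : I ⥤ E :=
      { obj := Z
        map := fun φ => m φ
        map_id := fun i => by rw [← cancel_mono (d i), hm]; simp
        map_comp := fun φ ψ => by rw [← cancel_mono (d _), hm, Category.assoc, hm]; simp [reassoc_of% hm] }
    exact ⟨Z', { app := d, naturality := fun i j φ => (hm φ) }, by ext i; exact w i, h⟩

variable (I E)

/-- The category of diagrams of shape `I` in an exact category `E` is an exact category,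
with the conflations defined componentwise. -/
instance diagram : ExactCategory (I ⥤ E) where
  conflation := diagramConflation I E
  closedUnderIso :=
    { of_iso := fun {S T} e hS i =>
        closedUnderIso.of_iso (((evaluation I E).obj i).mapShortComplex.mapIso e) (hS i) }
  isKernel S hS := by
    have hm (i : I) : Mono (S.f.app i) := mono_of_conflation (hS i)
    have : Mono S.f := NatTrans.mono_of_mono_app _
    have ex {W : I ⥤ E} (k : W ⟶ S.X₂) (hk : k ≫ S.g = 0) : ∃ l : W ⟶ S.X₁, l ≫ S.f = k := by
      have h (i : I) : ∃ l : W.obj i ⟶ S.X₁.obj i, l ≫ S.f.app i = k.app i :=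
        exists_lift_of_conflation (hS i) (k.app i) (congr_app hk i)
      choose l hl using h
      refine ⟨{ app := l, naturality := fun i j φ => ?_ }, by ext i; exact hl i⟩
      rw [← cancel_mono (S.f.app j), Category.assoc, hl, Category.assoc, NatTrans.naturality, NatTrans.naturality,
        reassoc_of% hl]
    choose l hl using @ex
    exact ⟨KernelFork.IsLimit.ofι _ _ (fun k hk => l k hk) (fun k hk => hl k hk)
      (fun k hk m hm => by rw [← cancel_mono S.f, hm, hl])⟩
  isCokernel S hS := by
    have hm (i : I) : Epi (S.g.app i) := epi_of_conflation (hS i)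
    have : Epi S.g := NatTrans.epi_of_epi_app _
    have ex {W : I ⥤ E} (k : S.X₂ ⟶ W) (hk : S.f ≫ k = 0) : ∃ l : S.X₃ ⟶ W, S.g ≫ l = k := by
      have h (i : I) : ∃ l : S.X₃.obj i ⟶ W.obj i, S.g.app i ≫ l = k.app i :=
        exists_desc_of_conflation (hS i) (k.app i) (congr_app hk i)
      choose l hl using h
      refine ⟨{ app := l, naturality := fun i j φ => ?_ }, by ext i; exact hl i⟩
      rw [← cancel_epi (S.g.app i), ← NatTrans.naturality_assoc, hl, reassoc_of% hl,
        NatTrans.naturality]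
    choose l hl using @ex
    exact ⟨CokernelCofork.IsColimit.ofπ _ _ (fun k hk => l k hk) (fun k hk => hl k hk)
      (fun k hk m hm => by rw [← cancel_epi S.g, hm, hl])⟩
  id_inflation X := by
    rw [diagramConflation_firstMaps_iff]
    exact fun i => id_inflation (X.obj i)
  id_deflation X := by
    rw [diagramConflation_secondMaps_iff]
    exact fun i => id_deflation (X.obj i)
  comp_inflation f g hf hg := by
    rw [diagramConflation_firstMaps_iff] at hf hg ⊢
    exact fun i => comp_inflation _ _ (hf i) (hg i)
  comp_deflation f g hf hg := by
    rw [diagramConflation_secondMaps_iff] at hf hg ⊢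
    exact fun i => comp_deflation _ _ (hf i) (hg i)
  pushout_inflation {X Y X'} i f hi := by
    rw [diagramConflation_firstMaps_iff] at hi
    choose Y' f' i' sq hi' using fun j => pushout_inflation (i.app j) (f.app j) (hi j)
    let Z : I ⥤ E :=
      { obj := Y'
        map := fun {j k} φ => (sq j).desc (Y.map φ ≫ f' k) (X'.map φ ≫ i' k) (by
          rw [← NatTrans.naturality_assoc, ← NatTrans.naturality_assoc, (sq k).w])
        map_id := fun j => (sq j).hom_ext (by simp) (by simp)
        map_comp := fun φ ψ => (sq _).hom_ext (by simp) (by simp) }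
    let F : Y ⟶ Z := { app := f', naturality := fun j k φ => by simp [Z] }
    let J : X' ⟶ Z := { app := i', naturality := fun j k φ => by simp [Z] }
    refine ⟨Z, F, J, IsPushout.of_forall_isPushout_app sq, ?_⟩
    rw [diagramConflation_firstMaps_iff]
    exact hi'
  pullback_deflation {Y Z Z'} d f hd := by
    rw [diagramConflation_secondMaps_iff] at hd
    choose Y' f' d' sq hd' using fun j => pullback_deflation (d.app j) (f.app j) (hd j)
    let T : I ⥤ E :=
      { obj := Y'
        map := fun {j k} φ => (sq k).lift (f' j ≫ Y.map φ) (d' j ≫ Z'.map φ) (by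
          rw [Category.assoc, Category.assoc, NatTrans.naturality, NatTrans.naturality,
            reassoc_of% (sq j).w])
        map_id := fun j => (sq j).hom_ext (by simp) (by simp)
        map_comp := fun φ ψ => (sq _).hom_ext (by simp) (by simp) }
    let F : T ⟶ Y := { app := f', naturality := fun j k φ => by simp [T] }
    let J : T ⟶ Z' := { app := d', naturality := fun j k φ => by simp [T] }
    refine ⟨T, F, J, IsPullback.of_forall_isPullback_app sq, ?_⟩
    rw [diagramConflation_secondMaps_iff]
    exact hd'

end ExactCategory

end CategoryTheory

namespace CategoryTheory

/-! ### Localization of strict 2-functors with values in categories -/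

lemma op2_unop_eqToIso {B : Type u} [Bicategory.{w, v} B] {a b : Bᵒᵖ} {f g : a ⟶ b}
    (h : f.unop = g.unop) : (eqToIso h).op2_unop = eqToIso (Quiver.Hom.unop_inj h) := by
  obtain rfl : f = g := Quiver.Hom.unop_inj h
  rfl

/-- The `1`-cell dual of a strict bicategory is strict. -/
instance strict_op {B : Type u} [Bicategory.{w, v} B] [Bicategory.Strict B] :
    Bicategory.Strict Bᵒᵖ where
  id_comp f := congrArg Quiver.Hom.op (Bicategory.Strict.comp_id f.unop)
  comp_id f := congrArg Quiver.Hom.op (Bicategory.Strict.id_comp f.unop)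
  assoc f g h := congrArg Quiver.Hom.op (Bicategory.Strict.assoc h.unop g.unop f.unop).symm
  leftUnitor_eqToIso f := by
    change (ρ_ f.unop).op2_unop = _
    rw [Bicategory.Strict.rightUnitor_eqToIso]
    exact op2_unop_eqToIso _
  rightUnitor_eqToIso f := by
    change (λ_ f.unop).op2_unop = _
    rw [Bicategory.Strict.leftUnitor_eqToIso]
    exact op2_unop_eqToIso _
  associator_eqToIso f g h := by
    change (α_ h.unop g.unop f.unop).op2_unop.symm = _
    rw [Bicategory.Strict.associator_eqToIso]
    exact (congr_arg Iso.symm (op2_unop_eqToIso _)).trans rfl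

namespace Localization.Construction

variable {C : Type u} [Category.{v} C] {W : MorphismProperty C} {D : Type u'} [Category.{v'} D]

lemma lift_map_Q (F : C ⥤ D) (hF : W.IsInvertedBy F) {X Y : C} (f : X ⟶ Y) :
    (lift F hF).map (W.Q.map f) = F.map f :=
  (Functor.congr_hom (fac F hF) f).trans ((Category.id_comp _).trans (Category.comp_id _))

/-- The natural transformation between lifts to the localized category that is induced by
a natural transformation. -/
noncomputable def liftNatTrans {F₁ F₂ : C ⥤ D} (h₁ : W.IsInvertedBy F₁) (h₂ : W.IsInvertedBy F₂)
    (τ : F₁ ⟶ F₂) : lift F₁ h₁ ⟶ lift F₂ h₂ :=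
  natTransExtension (eqToHom (fac F₁ h₁) ≫ τ ≫ eqToHom (fac F₂ h₂).symm)

@[simp]
lemma liftNatTrans_app_Q {F₁ F₂ : C ⥤ D} (h₁ : W.IsInvertedBy F₁) (h₂ : W.IsInvertedBy F₂)
    (τ : F₁ ⟶ F₂) (X : C) : (liftNatTrans h₁ h₂ τ).app (W.Q.obj X) = τ.app X := by
  refine (NatTransExtension.app_eq _ X).trans ?_
  rw [NatTrans.comp_app, NatTrans.comp_app, eqToHom_app, eqToHom_app]
  exact (Category.id_comp _).trans (Category.comp_id _)

lemma natTrans_ext {F₁ F₂ : W.Localization ⥤ D} {τ τ' : F₁ ⟶ F₂}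
    (h : ∀ X : C, τ.app (W.Q.obj X) = τ'.app (W.Q.obj X)) : τ = τ' := by
  ext ⟨⟨X⟩⟩
  exact h X

end Localization.Construction

open Localization.Construction in
/-- The strict 2-functor obtained from a strict 2-functor `S` with values in categories by
localizing each category `S.obj b` at a class of morphisms `W b`. -/
noncomputable def StrictPseudofunctor.localized {B : Type u₂} [Bicategory.{w₂, v₂} B] [Bicategory.Strict B]
    (S : StrictPseudofunctor B Cat.{v, u}) (W : ∀ b, MorphismProperty (S.obj b))
    (hW : ∀ {a b : B} (f : a ⟶ b), (W a).IsInvertedBy ((S.map f).toFunctor ⋙ (W b).Q)) :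
    StrictPseudofunctor B Cat.{max u v, u} :=
  StrictPseudofunctor.mk''
    { obj := fun b => Cat.of (W b).Localization
      map := fun f => (lift _ (hW f)).toCatHom
      map₂ := fun {a b f g} η =>
        (liftNatTrans (hW f) (hW g) (Functor.whiskerRight (S.map₂ η).toNatTrans (W b).Q)).toCatHom₂
      map₂_id := fun {a b} f => by
        ext1
        apply natTrans_ext
        intro X
        refine (liftNatTrans_app_Q _ _ _ X).trans ?_
        rw [S.map₂_id]
        exact (W b).Q.map_id _
      map₂_comp := fun {a b f g h} η θ => by
        ext1
        apply natTrans_ext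
        intro X
        refine (liftNatTrans_app_Q _ _ _ X).trans ?_
        rw [S.map₂_comp]
        refine ((W b).Q.map_comp _ _).trans ?_
        exact (congr_arg₂ (fun x y => x ≫ y) (liftNatTrans_app_Q (hW f) (hW g)
            (Functor.whiskerRight (S.map₂ η).toNatTrans (W b).Q) X)
          (liftNatTrans_app_Q (hW g) (hW h)
            (Functor.whiskerRight (S.map₂ θ).toNatTrans (W b).Q) X)).symm
      map_id := fun a => by
        ext1
        apply uniq
        refine (fac _ _).trans ?_
        rw [S.map_id]
        rfl
      map_comp := fun {a b c} f g => by
        ext1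
        apply uniq
        refine (fac _ _).trans ?_
        rw [S.map_comp]
        exact ((congr_arg (fun T => T ⋙ lift _ (hW g)) (fac _ (hW f))).trans
          (congr_arg (fun T => (S.map f).toFunctor ⋙ T) (fac _ (hW g)))).symm
      map₂_whisker_left := fun {a b c} f {g g'} η => by
        ext1
        apply natTrans_ext
        intro X
        refine (liftNatTrans_app_Q _ _ _ X).trans ?_
        rw [S.map₂_whisker_left, S.mapComp_eq_eqToIso, S.mapComp_eq_eqToIso, eqToIso.hom, eqToIso.inv]
        refine ((W c).Q.map_comp _ _).trans
          (congr_arg₂ (fun x y => x ≫ y) ?_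
            (((W c).Q.map_comp _ _).trans
              (congr_arg₂ (fun x y => x ≫ y) ?_ ?_)))
        · rw [Cat.eqToHom_app]
          refine (eqToHom_map (W c).Q _).trans ?_
          symm
          erw [Cat.eqToHom_app]
          rfl
        rotate_left
        · rw [Cat.eqToHom_app]
          refine (eqToHom_map (W c).Q _).trans ?_
          symm
          erw [Cat.eqToHom_app]
          rfl
        exact (liftNatTrans_app_Q (hW g) (hW g')
          (Functor.whiskerRight (S.map₂ η).toNatTrans (W c).Q) ((S.map f).toFunctor.obj X)).symm
      map₂_whisker_right := fun {a b c f f'} η g => by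
        ext1
        apply natTrans_ext
        intro X
        refine (liftNatTrans_app_Q _ _ _ X).trans ?_
        rw [S.map₂_whisker_right, S.mapComp_eq_eqToIso, S.mapComp_eq_eqToIso, eqToIso.hom, eqToIso.inv]
        refine ((W c).Q.map_comp _ _).trans
          (congr_arg₂ (fun x y => x ≫ y) ?_
            (((W c).Q.map_comp _ _).trans
              (congr_arg₂ (fun x y => x ≫ y) ?_ ?_)))
        · rw [Cat.eqToHom_app]
          refine (eqToHom_map (W c).Q _).trans ?_
          symm
          erw [Cat.eqToHom_app]
          rfl
        rotate_left
        · rw [Cat.eqToHom_app]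
          refine (eqToHom_map (W c).Q _).trans ?_
          symm
          erw [Cat.eqToHom_app]
          rfl
        exact ((congr_arg (lift _ (hW g)).map (liftNatTrans_app_Q (hW f) (hW f')
          (Functor.whiskerRight (S.map₂ η).toNatTrans (W b).Q) X)).trans (lift_map_Q _ _ _)).symm }

/-- A strict transformation between strict 2-functors with values in categories: functors
which commute strictly with the values of the 2-functors on `1`-cells and on `2`-cells. -/
structure StrictTrans {B : Type u₂} [Bicategory.{w₂, v₂} B] [Bicategory.Strict B]
    (S T : StrictPseudofunctor B Cat.{v, u}) where
  /-- the components -/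
  app (b : B) : S.obj b ⟶ T.obj b
  naturality {a b : B} (f : a ⟶ b) : S.map f ≫ app b = app a ≫ T.map f
  naturality₂ {a b : B} {f g : a ⟶ b} (η : f ⟶ g) :
    S.map₂ η ▷ app b ≫ eqToHom (naturality g) = eqToHom (naturality f) ≫ app a ◁ T.map₂ η

namespace StrictTrans

variable {B : Type u₂} [Bicategory.{w₂, v₂} B] [Bicategory.Strict B]
  {S T : StrictPseudofunctor B Cat.{v, u}}

attribute [local simp] Strict.leftUnitor_eqToIso Strict.rightUnitor_eqToIso
  Strict.associator_eqToIso

/-- The pseudonatural transformation given by a strict transformation. -/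
def toStrongTrans (F : StrictTrans S T) :
    Pseudofunctor.StrongTrans S.toPseudofunctor T.toPseudofunctor where
  app b := F.app b
  naturality f := eqToIso (F.naturality f)
  naturality_naturality η := F.naturality₂ η
  naturality_id a := by
    simp [StrictlyUnitaryPseudofunctor.mapId_eq_eqToIso]
  naturality_comp f g := by
    simp only [StrictPseudofunctor.mapComp_eq_eqToIso, eqToIso.hom, eqToIso.inv,
      Strict.associator_eqToIso, whiskerLeft_eqToHom, eqToHom_whiskerRight, eqToHom_trans]

end StrictTrans

end CategoryTheory

namespace CategoryTheory

/-! ### The derived category of an exact category -/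

namespace ExactCategory

section

variable {E : Type u} [Category.{v} E] [Preadditive E] [HasZeroObject E] [HasBinaryBiproducts E]
  [ExactCategory E]

/-- A complex `K` over an exact category is acyclic if each differential factors as
`K.X n --p n--> Z (n + 1) --i (n + 1)--> K.X (n + 1)` in such a way that
`Z n --i n--> K.X n --p n--> Z (n + 1)` is a conflation for all `n`. -/
def IsAcyclic (K : CochainComplex E ℤ) : Prop :=
  ∃ (Z : ℤ → E) (i : ∀ n, Z n ⟶ K.X n) (p : ∀ n, K.X n ⟶ Z (n + 1)) (w : ∀ n, i n ≫ p n = 0),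
    (∀ n, p n ≫ i (n + 1) = K.d n (n + 1)) ∧ ∀ n, conflation (ShortComplex.mk (i n) (p n) (w n))

lemma conflation_of_isZero {S : ShortComplex E} (h₁ : IsZero S.X₁) (h₂ : IsZero S.X₂)
    (h₃ : IsZero S.X₃) : conflation S := by
  obtain ⟨Z, d, w, h⟩ := id_inflation S.X₁
  have hZ : IsZero Z := by
    have : Epi d := epi_of_conflation h
    rw [IsZero.iff_id_eq_zero, ← cancel_epi d]
    exact h₁.eq_of_src _ _
  exact closedUnderIso.of_iso (show ShortComplex.mk (𝟙 S.X₁) d w ≅ S from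
    ShortComplex.isoMk (Iso.refl _) (h₁.iso h₂) (hZ.iso h₃)
      (h₁.eq_of_src _ _) (h₁.eq_of_src _ _)) h

lemma isAcyclic_of_isZero {K : CochainComplex E ℤ} (hK : ∀ n, IsZero (K.X n)) : IsAcyclic K :=
  ⟨K.X, fun _ => 𝟙 _, fun _ => 0, fun n => (hK n).eq_of_src _ _,
    fun n => (hK n).eq_of_src _ _, fun n => conflation_of_isZero (hK n) (hK n) (hK (n + 1))⟩

variable (E)

/-- The class of the acyclic complexes, in the homotopy category `K(E)`. -/
def acyclic : ObjectProperty (HomotopyCategory E (ComplexShape.up ℤ)) :=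
  fun K => IsAcyclic K.as

instance : (acyclic E).Nonempty := by
  obtain ⟨K, hK⟩ := HasZeroObject.zero (C := CochainComplex E ℤ)
  exact ⟨(HomotopyCategory.quotient _ _).obj K, isAcyclic_of_isZero
    (fun n => (HomologicalComplex.eval E (ComplexShape.up ℤ) n).map_isZero hK)⟩

/-- The morphisms in `K(E)` which are inverted in the derived category `D(E)`: those whose
cone lies in the thick subcategory of `K(E)` generated by the acyclic complexes. (A Verdier
quotient by a class of objects is the same as the quotient by the thick
subcategory which it generates. If `E` is idempotent complete, the acyclic complexes
form a thick subcategory.) -/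
abbrev quasiIso : MorphismProperty (HomotopyCategory E (ComplexShape.up ℤ)) :=
  (acyclic E).triangEnvelope.trW

/-- The derived category `D(E)` of an exact category `E`: the Verdier quotient
of the homotopy category `K(E)` by the acyclic complexes, with its
structure of a triangulated category. -/
abbrev Derived : Type (max u v) := (quasiIso E).Localization

/-- The quotient functor `K(E) ⥤ D(E)`. -/
abbrev Derived.Qh : HomotopyCategory E (ComplexShape.up ℤ) ⥤ Derived E := (quasiIso E).Q

end

/-! ### Functors induced between derived categories -/

section

variable {E : Type u} [Category.{v} E] [Preadditive E] [HasZeroObject E] [HasBinaryBiproducts E]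
  [ExactCategory E]
  {E' : Type u'} [Category.{v'} E'] [Preadditive E'] [HasZeroObject E'] [HasBinaryBiproducts E']
  [ExactCategory E']

lemma quasiIso_map (G : E ⥤ E') [G.Additive]
    (hG : ∀ S : ShortComplex E, conflation S → conflation (S.map G)) :
    quasiIso E ≤ (quasiIso E').inverseImage (G.mapHomotopyCategory (ComplexShape.up ℤ)) := by
  have : ((acyclic E').triangEnvelope.inverseImage
      (G.mapHomotopyCategory (ComplexShape.up ℤ))).IsStableUnderRetracts :=
    ⟨fun r h => (acyclic E').triangEnvelope.prop_of_retract (r.map _) h⟩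
  have h : (acyclic E).triangEnvelope ≤
      (acyclic E').triangEnvelope.inverseImage (G.mapHomotopyCategory (ComplexShape.up ℤ)) := by
    rw [ObjectProperty.triangEnvelope_le_iff]
    rintro K ⟨Z, i, p, w, h₁, h₂⟩
    refine ObjectProperty.le_triangEnvelope _ _ ⟨fun n => G.obj (Z n), fun n => G.map (i n),
      fun n => G.map (p n), fun n => ?_, fun n => ?_, fun n => hG _ (h₂ n)⟩
    · exact (G.map_comp _ _).symm.trans ((congr_arg G.map (w n)).trans (G.map_zero _ _))
    · exact (G.map_comp _ _).symm.trans (congr_arg G.map (h₁ n))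
  intro K L f hf
  exact (ObjectProperty.inverseImage_trW_iff _ _ _).1 (ObjectProperty.trW_monotone h _ hf)

end

section

variable {E : Type u} [Category.{v} E] [Preadditive E] [HasZeroObject E] [HasBinaryBiproducts E]
  [ExactCategory E] {A : Type u'} [Category.{v'} A] [Abelian A]

/-- A functor from an exact category to an abelian category is exact if it is additive and
sends conflations to short exact sequences. -/
class IsExactFunctor (G : E ⥤ A) : Prop extends G.Additive where
  map_conflation (S : ShortComplex E) : conflation S → (S.map G).ShortExact

instance : (HomotopyCategory.subcategoryAcyclic A).IsStableUnderRetracts where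
  of_retract r h := by
    rw [HomotopyCategory.mem_subcategoryAcyclic_iff] at h ⊢
    intro n
    rw [IsZero.iff_id_eq_zero]
    have hr := r.map (HomotopyCategory.homologyFunctor A (ComplexShape.up ℤ) n)
    rw [← hr.retract, (h n).eq_of_src hr.r 0, comp_zero]

lemma mapHomotopyCategory_acyclic (G : E ⥤ A) [IsExactFunctor G]
    {K : HomotopyCategory E (ComplexShape.up ℤ)} (hK : acyclic E K) :
    HomotopyCategory.subcategoryAcyclic A
      ((G.mapHomotopyCategory (ComplexShape.up ℤ)).obj K) := by
  obtain ⟨Z, i, p, w, h₁, h₂⟩ := hK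
  refine (HomotopyCategory.quotient_obj_mem_subcategoryAcyclic_iff_exactAt
    ((G.mapHomologicalComplex _).obj K.as)).2 (fun n => ?_)
  obtain ⟨m, rfl⟩ : ∃ m, n = m + 1 := ⟨n - 1, by lia⟩
  have ex := (IsExactFunctor.map_conflation (G := G) _ (h₂ (m + 1)))
  have ex' := (IsExactFunctor.map_conflation (G := G) _ (h₂ m))
  have ex'' := (IsExactFunctor.map_conflation (G := G) _ (h₂ (m + 1 + 1)))
  have := ex'.epi_g
  have := ex''.mono_f
  rw [HomologicalComplex.exactAt_iff' _ m (m + 1) (m + 1 + 1) (by simp) (by simp)]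
  let φ : ShortComplex.mk (G.map (p m) ≫ G.map (i (m + 1))) (G.map (p (m + 1)))
      (by rw [Category.assoc, ← G.map_comp, w, G.map_zero, comp_zero]) ⟶
      (ShortComplex.mk (G.map (i (m + 1))) (G.map (p (m + 1)))
        (by rw [← G.map_comp, w, G.map_zero])) :=
    { τ₁ := G.map (p m), τ₂ := 𝟙 _, τ₃ := 𝟙 _ }
  let ψ : ShortComplex.mk (G.map (p m) ≫ G.map (i (m + 1))) (G.map (p (m + 1)))
      (by rw [Category.assoc, ← G.map_comp, w, G.map_zero, comp_zero]) ⟶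
      (((G.mapHomologicalComplex (ComplexShape.up ℤ)).obj K.as).sc' m (m + 1) (m + 1 + 1)) :=
    { τ₁ := 𝟙 _, τ₂ := 𝟙 _, τ₃ := G.map (i (m + 1 + 1))
      comm₁₂ := by
        refine (Category.id_comp _).trans (Eq.trans ?_ (Category.comp_id _).symm)
        exact (congr_arg G.map (h₁ m).symm).trans (G.map_comp _ _)
      comm₂₃ := by
        refine (Category.id_comp _).trans ?_
        exact (congr_arg G.map (h₁ (m + 1)).symm).trans (G.map_comp _ _) }
  have : Epi φ.τ₁ := ex'.epi_g
  have : IsIso φ.τ₂ := inferInstanceAs (IsIso (𝟙 _))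
  have : Mono φ.τ₃ := inferInstanceAs (Mono (𝟙 _))
  have : Epi ψ.τ₁ := inferInstanceAs (Epi (𝟙 _))
  have : IsIso ψ.τ₂ := inferInstanceAs (IsIso (𝟙 _))
  have : Mono ψ.τ₃ := ex''.mono_f
  rw [← ShortComplex.exact_iff_of_epi_of_isIso_of_mono ψ,
    ShortComplex.exact_iff_of_epi_of_isIso_of_mono φ]
  exact ex.exact

/-- The morphisms in `K(E)` which are inverted in `D(E)` are sent to quasi-isomorphisms by an
exact functor to an abelian category. -/
lemma quasiIso_le (G : E ⥤ A) [IsExactFunctor G] :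
    quasiIso E ≤ (HomotopyCategory.quasiIso A (ComplexShape.up ℤ)).inverseImage
      (G.mapHomotopyCategory (ComplexShape.up ℤ)) := by
  have : ((HomotopyCategory.subcategoryAcyclic A).inverseImage
      (G.mapHomotopyCategory (ComplexShape.up ℤ))).IsStableUnderRetracts :=
    ⟨fun r h => (HomotopyCategory.subcategoryAcyclic A).prop_of_retract (r.map _) h⟩
  have h : (acyclic E).triangEnvelope ≤
      (HomotopyCategory.subcategoryAcyclic A).inverseImage
        (G.mapHomotopyCategory (ComplexShape.up ℤ)) := by
    rw [ObjectProperty.triangEnvelope_le_iff]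
    intro K hK
    exact mapHomotopyCategory_acyclic G hK
  intro K L f hf
  rw [HomotopyCategory.quasiIso_eq_trW_subcategoryAcyclic]
  exact (ObjectProperty.inverseImage_trW_iff _ _ _).1 (ObjectProperty.trW_monotone h _ hf)

variable [HasDerivedCategory.{w} A]

lemma isInvertedBy_Qh (G : E ⥤ A) [IsExactFunctor G] :
    (quasiIso E).IsInvertedBy
      (G.mapHomotopyCategory (ComplexShape.up ℤ) ⋙ DerivedCategory.Qh) :=
  fun _ _ f hf => Localization.inverts DerivedCategory.Qh
    (HomotopyCategory.quasiIso A (ComplexShape.up ℤ)) _ (quasiIso_le G f hf)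

/-- The functor `D(E) ⥤ D(A)` induced by an exact functor `E ⥤ A`
from an exact category to an abelian category. -/
noncomputable def derivedFunctor (G : E ⥤ A) [IsExactFunctor G] : Derived E ⥤ DerivedCategory A :=
  Localization.Construction.lift
    (G.mapHomotopyCategory (ComplexShape.up ℤ) ⋙ DerivedCategory.Qh) (isInvertedBy_Qh G)

noncomputable instance (G : E ⥤ A) [IsExactFunctor G] :
    Localization.Lifting (Derived.Qh E) (quasiIso E)
      (G.mapHomotopyCategory (ComplexShape.up ℤ) ⋙ DerivedCategory.Qh) (derivedFunctor G) :=
  ⟨eqToIso (Localization.Construction.fac _ _)⟩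

/-- The canonical compatibility of the induced functor `D(E) ⥤ D(A)` with the shifts. -/
noncomputable instance (G : E ⥤ A) [IsExactFunctor G] : (derivedFunctor G).CommShift ℤ :=
  Functor.commShiftOfLocalization (Derived.Qh E) (quasiIso E) ℤ
    (G.mapHomotopyCategory (ComplexShape.up ℤ) ⋙ DerivedCategory.Qh) (derivedFunctor G)

end

end ExactCategory

end CategoryTheory

namespace CategoryTheory

/-! ### The prederivators of an abelian category and of an exact category -/

lemma Cat.hom₂_eq_of_heq {C D : Cat.{v, u}} {F₁ F₂ G₁ G₂ : C ⟶ D} (h : F₁ = F₂) (h' : G₂ = G₁)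
    (τ : F₂ ⟶ G₂) (τ' : F₁ ⟶ G₁) (e : ∀ K, τ'.toNatTrans.app K ≍ τ.toNatTrans.app K) :
    τ' = eqToHom h ≫ τ ≫ eqToHom h' := by
  subst h h'
  ext K
  simpa using eq_of_heq (e K)

section

variable (V : Type u) [Category.{v} V] [Preadditive V]

instance additive_whiskeringLeft_obj {I J : Type*} [Category* I] [Category* J] (F : I ⥤ J) :
    ((Functor.whiskeringLeft I J V).obj F).Additive where

/-- A strict 2-functor on the 1-cell dual of the 2-category of small categories. -/
abbrev Prederivator := StrictPseudofunctor (Cat.{w, w})ᵒᵖ Cat.{v, u}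

/-- The strict 2-functor which sends a small category `I` to the category `Ch(V^I)` of
complexes of diagrams of shape `I`. -/
def diagramComplexes : Prederivator.{w, max w v, max w v u} :=
  StrictPseudofunctor.mk''
    { obj := fun I => Cat.of (CochainComplex (I.unop ⥤ V) ℤ)
      map := fun u => (((Functor.whiskeringLeft _ _ V).obj
        u.unop.toFunctor).mapHomologicalComplex (ComplexShape.up ℤ)).toCatHom
      map₂ := fun α => (NatTrans.mapHomologicalComplex
        ((Functor.whiskeringLeft _ _ V).map α.unop2.toNatTrans) (ComplexShape.up ℤ)).toCatHom₂
      map₂_id := fun f => by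
        ext K
        refine HomologicalComplex.hom_ext _ _ (fun n => ?_)
        ext i
        exact (K.X n).map_id _
      map₂_comp := fun f g => by
        ext K
        refine HomologicalComplex.hom_ext _ _ (fun n => ?_)
        ext i
        exact (K.X n).map_comp _ _
      map_id := fun I => by
        rfl
      map_comp := fun u v => by
        rfl
      map₂_whisker_left := fun f g g' η => by
        exact Cat.hom₂_eq_of_heq _ _ _ _ (fun K => heq_of_eq rfl)
      map₂_whisker_right := fun η g => by
        exact Cat.hom₂_eq_of_heq _ _ _ _ (fun K => heq_of_eq rfl) }

/-- The strict 2-functor which sends a small category `I` to the homotopy category `K(V^I)` of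
complexes of diagrams of shape `I`. -/
def diagramHomotopyCategories : Prederivator.{w, max w v, max w v u} :=
  StrictPseudofunctor.mk''
    { obj := fun I => Cat.of (HomotopyCategory (I.unop ⥤ V) (ComplexShape.up ℤ))
      map := fun u => (((Functor.whiskeringLeft _ _ V).obj
        u.unop.toFunctor).mapHomotopyCategory (ComplexShape.up ℤ)).toCatHom
      map₂ := fun α => (NatTrans.mapHomotopyCategory
        ((Functor.whiskeringLeft _ _ V).map α.unop2.toNatTrans) (ComplexShape.up ℤ)).toCatHom₂
      map₂_id := fun f => by
        ext K
        refine (congr_arg (HomotopyCategory.quotient _ _).map ?_).trans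
          ((HomotopyCategory.quotient _ _).map_id _)
        ext n i
        exact (K.as.X n).map_id _
      map₂_comp := fun f g => by
        ext K
        refine (congr_arg (HomotopyCategory.quotient _ _).map ?_).trans
          ((HomotopyCategory.quotient _ _).map_comp _ _)
        ext n i
        exact (K.as.X n).map_comp _ _
      map_id := fun I => by
        ext1
        exact Quotient.lift_unique' _ _ _ rfl
      map_comp := fun u v => by
        ext1
        exact Quotient.lift_unique' _ _ _ rfl
      map₂_whisker_left := fun f g g' η => by
        exact Cat.hom₂_eq_of_heq _ _ _ _ (fun K => heq_of_eq rfl)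
      map₂_whisker_right := fun η g => by
        exact Cat.hom₂_eq_of_heq _ _ _ _ (fun K => heq_of_eq rfl) }

end
end CategoryTheory

namespace CategoryTheory

namespace ExactCategory

section

variable {E : Type u} [Category.{v} E] [Preadditive E] [HasZeroObject E] [HasBinaryBiproducts E]
  [ExactCategory E] {A : Type u'} [Category.{v'} A] [Abelian A]

lemma shortExact_of_evaluation {I : Type w} [Category.{w'} I] {S : ShortComplex (I ⥤ A)}
    (h : ∀ i, (S.map ((evaluation I A).obj i)).ShortExact) : S.ShortExact where
  mono_f := by
    have (i : I) : Mono (S.f.app i) := (h i).mono_f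
    exact NatTrans.mono_of_mono_app _
  epi_g := by
    have (i : I) : Epi (S.g.app i) := (h i).epi_g
    exact NatTrans.epi_of_epi_app _
  exact := by
    rw [ShortComplex.exact_iff_isZero_homology, Functor.isZero_iff]
    exact fun i => ((ShortComplex.exact_iff_isZero_homology _).1 (h i).exact).of_iso
      (S.mapHomologyIso ((evaluation I A).obj i)).symm

/-- An exact functor induces componentwise an exact functor on diagrams. -/
instance isExactFunctor_whiskeringRight (I : Type w) [Category.{w'} I] (G : E ⥤ A)
    [IsExactFunctor G] : IsExactFunctor ((Functor.whiskeringRight I E A).obj G) where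
  map_conflation _ hS :=
    shortExact_of_evaluation (fun i => IsExactFunctor.map_conflation (G := G) _ (hS i))

variable (E) in
lemma isInvertedBy_whiskeringLeft {I J : Type w} [Category.{w'} I] [Category.{w'} J]
    (f : J ⥤ I) :
    (quasiIso (I ⥤ E)).IsInvertedBy
      ((((Functor.whiskeringLeft _ _ E).obj f).mapHomotopyCategory (ComplexShape.up ℤ)) ⋙
        (quasiIso (J ⥤ E)).Q) :=
  fun _ _ s hs => MorphismProperty.Q_inverts _ _
    (quasiIso_map ((Functor.whiskeringLeft _ _ E).obj f) (fun _ hS j =>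
      (show diagramConflation I E _ from hS) (f.obj j)) s hs)

variable (A) in
lemma isInvertedBy_whiskeringLeft' {I J : Type w} [Category.{w'} I] [Category.{w'} J]
    (f : J ⥤ I) :
    (HomologicalComplex.quasiIso (I ⥤ A) (ComplexShape.up ℤ)).IsInvertedBy
      ((((Functor.whiskeringLeft _ _ A).obj f).mapHomologicalComplex (ComplexShape.up ℤ)) ⋙
        (HomologicalComplex.quasiIso (J ⥤ A) (ComplexShape.up ℤ)).Q) := by
  intro K L s hs
  refine MorphismProperty.Q_inverts _ _ ?_
  rw [HomologicalComplex.mem_quasiIso_iff, HomologicalComplex.quasiIso_iff_evaluation] at hs ⊢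
  exact fun j => hs (f.obj j)

end

variable (E : Type u) [Category.{v} E] [Preadditive E] [HasZeroObject E] [HasBinaryBiproducts E]
  [ExactCategory E]

/-- The prederivator `I ↦ D(E^I)` of an exact category `E`. -/
noncomputable def prederivator : Prederivator.{w, max w v u, max w v u} :=
  (diagramHomotopyCategories.{w} E).localized (fun I => quasiIso (I.unop ⥤ E))
    (fun u => isInvertedBy_whiskeringLeft E u.unop.toFunctor)

lemma prederivator_obj (I : Cat.{w, w}) :
    (prederivator.{w} E).obj (Opposite.op I) = Cat.of (Derived (I ⥤ E)) := rfl

end ExactCategory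

section

variable (A : Type u) [Category.{v} A] [Abelian A]

/-- The prederivator `I ↦ D(A^I)` of an abelian category `A`. -/
noncomputable def abelianPrederivator : Prederivator.{w, max w v u, max w v u} :=
  (diagramComplexes.{w} A).localized
    (fun I => HomologicalComplex.quasiIso (I.unop ⥤ A) (ComplexShape.up ℤ))
    (fun u => ExactCategory.isInvertedBy_whiskeringLeft' A u.unop.toFunctor)

attribute [local instance] HasDerivedCategory.standard

lemma abelianPrederivator_obj (I : Cat.{w, w}) :
    (abelianPrederivator.{w} A).obj (Opposite.op I) = Cat.of (DerivedCategory (I ⥤ A)) := rfl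

end

end CategoryTheory

namespace CategoryTheory

namespace ExactCategory

section

attribute [local instance] HasDerivedCategory.standard

variable {E : Type u} [Category.{v} E] [Preadditive E] {A : Type u} [Category.{v} A] [Abelian A]

lemma mapHomotopyCategory_comp_Qh_whiskeringLeft (G : E ⥤ A) [G.Additive]
    {I J : Cat.{w, w}} (f : J ⟶ I) :
    (((Functor.whiskeringRight I E A).obj G).mapHomotopyCategory (ComplexShape.up ℤ) ⋙
      DerivedCategory.Qh) ⋙
      ((abelianPrederivator.{w} A).map f.op).toFunctor =
    ((Functor.whiskeringLeft J I E).obj f.toFunctor).mapHomotopyCategory (ComplexShape.up ℤ) ⋙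
      (((Functor.whiskeringRight J E A).obj G).mapHomotopyCategory (ComplexShape.up ℤ) ⋙
      DerivedCategory.Qh) := by
  apply Quotient.lift_unique'
  exact congr_arg (fun T => ((Functor.whiskeringRight I E A).obj G).mapHomologicalComplex
    (ComplexShape.up ℤ) ⋙ T) (Localization.Construction.fac _
      (isInvertedBy_whiskeringLeft' A f.toFunctor))

variable [HasZeroObject E] [HasBinaryBiproducts E] [ExactCategory E]

lemma derivedFunctor_comp_map (G : E ⥤ A) [IsExactFunctor G] {I J : Cat.{w, w}} (f : J ⟶ I) :
    ((prederivator.{w} E).map f.op).toFunctor ⋙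
      derivedFunctor ((Functor.whiskeringRight J E A).obj G) =
    derivedFunctor ((Functor.whiskeringRight I E A).obj G) ⋙
      ((abelianPrederivator.{w} A).map f.op).toFunctor := by
  apply Localization.Construction.uniq
  refine Eq.trans (b := ((Functor.whiskeringLeft J I E).obj f.toFunctor).mapHomotopyCategory
    (ComplexShape.up ℤ) ⋙ (((Functor.whiskeringRight J E A).obj G).mapHomotopyCategory
      (ComplexShape.up ℤ) ⋙ DerivedCategory.Qh)) ?_ ?_
  · exact (congr_arg (fun T => T ⋙ derivedFunctor ((Functor.whiskeringRight J E A).obj G))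
      (Localization.Construction.fac _ (isInvertedBy_whiskeringLeft E f.toFunctor))).trans
        (congr_arg (fun T => ((Functor.whiskeringLeft J I E).obj f.toFunctor).mapHomotopyCategory
          (ComplexShape.up ℤ) ⋙ T) (Localization.Construction.fac _ (isInvertedBy_Qh
            ((Functor.whiskeringRight J E A).obj G))))
  · exact (mapHomotopyCategory_comp_Qh_whiskeringLeft G f).symm.trans
      (congr_arg (fun T => T ⋙ ((abelianPrederivator.{w} A).map f.op).toFunctor)
        (Localization.Construction.fac _ (isInvertedBy_Qh
            ((Functor.whiskeringRight I E A).obj G))).symm)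

/-- The morphism `D_E ⟶ D_A` of prederivators induced by an exact functor `G : E ⥤ A` from an
exact category to an abelian category, as a strict transformation: its component at `I` is
the functor `D(E^I) ⥤ D(A^I)` induced by `G`. -/
noncomputable def strictPrederivatorMap (G : E ⥤ A) [IsExactFunctor G] :
    StrictTrans (prederivator.{w} E) (abelianPrederivator.{w} A) where
  app I := (derivedFunctor ((Functor.whiskeringRight I.unop E A).obj G)).toCatHom
  naturality f := by
    ext1
    exact derivedFunctor_comp_map G f.unop
  naturality₂ {I J f g} η := by
    ext1
    apply Localization.Construction.natTrans_ext
    intro K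
    have e₁ := (congr_arg (derivedFunctor ((Functor.whiskeringRight J.unop E A).obj G)).map
        (Localization.Construction.liftNatTrans_app_Q
        (isInvertedBy_whiskeringLeft E f.unop.toFunctor)
        (isInvertedBy_whiskeringLeft E g.unop.toFunctor)
        (Functor.whiskerRight ((diagramHomotopyCategories E).map₂ η).toNatTrans
          (quasiIso (J.unop ⥤ E)).Q) K)).trans
        (Localization.Construction.lift_map_Q _ (isInvertedBy_Qh
          ((Functor.whiskeringRight J.unop E A).obj G)) _)
    have e₂ := Localization.Construction.liftNatTrans_app_Q
        (isInvertedBy_whiskeringLeft' A f.unop.toFunctor)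
        (isInvertedBy_whiskeringLeft' A g.unop.toFunctor)
        (Functor.whiskerRight ((diagramComplexes A).map₂ η).toNatTrans
          (HomologicalComplex.quasiIso (J.unop ⥤ A) (ComplexShape.up ℤ)).Q)
        (((((Functor.whiskeringRight I.unop E A).obj G).mapHomologicalComplex
          (ComplexShape.up ℤ)).obj K.as))
    refine (congr_arg₂ (fun x y => x ≫ y) e₁ (Cat.eqToHom_app _ _ _ _)).trans ?_
    symm
    refine (congr_arg₂ (fun x y => x ≫ y) (Cat.eqToHom_app _ _ _ _) e₂).trans ?_
    exact (Category.id_comp _).trans (Category.comp_id _).symm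

/-- The morphism `D_E ⟶ D_A` of prederivators (that is: the pseudonatural transformation)
induced by an exact functor `G : E ⥤ A` from an exact category to an abelian category. -/
noncomputable def prederivatorMap (G : E ⥤ A) [IsExactFunctor G] :
    Pseudofunctor.StrongTrans (prederivator.{w} E).toPseudofunctor
      (abelianPrederivator.{w} A).toPseudofunctor :=
  (strictPrederivatorMap G).toStrongTrans

lemma prederivatorMap_app (G : E ⥤ A) [IsExactFunctor G] (I : Cat.{w, w}) :
    ((prederivatorMap.{w} G).app (Opposite.op I)).toFunctor =
      derivedFunctor ((Functor.whiskeringRight I E A).obj G) := rfl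

end

end ExactCategory

end CategoryTheory

namespace CategoryTheory

/-- An equivalence of prederivators is a morphism all of whose components are equivalences
of categories. -/
def Pseudofunctor.StrongTrans.IsComponentwiseEquivalence {B : Type u₂} [Bicategory.{w₂, v₂} B]
    {S T : Pseudofunctor B Cat.{v, u}} (F : Pseudofunctor.StrongTrans S T) : Prop :=
  ∀ b, (F.app b).toFunctor.IsEquivalence

/-! ### Resolving subcategories -/

namespace ObjectProperty

variable {A : Type u} [Category.{v} A] [Abelian A] (P : ObjectProperty A)

/-- A full subcategory of an abelian category is resolving if it is closed under retracts, if
for any short exact sequence `0 ⟶ X ⟶ Y ⟶ Z ⟶ 0` with `Z` in the subcategory, `X` is in the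
subcategory if and only if `Y` is, and if any object is a quotient of an object
of the subcategory. -/
class IsResolving : Prop extends P.IsStableUnderRetracts where
  prop_X₁_iff_prop_X₂ (S : ShortComplex A) (hS : S.ShortExact) (h₃ : P S.X₃) : P S.X₁ ↔ P S.X₂
  exists_epi (X : A) : ∃ (Y : A) (f : Y ⟶ X), P Y ∧ Epi f

/-- A resolving subcategory is functorially resolving if the epimorphisms from objects of the
subcategory can be chosen functorially. -/
class IsFunctoriallyResolving : Prop extends P.IsResolving where
  exists_functor : ∃ (F : A ⥤ A) (π : F ⟶ 𝟭 A), ∀ X : A, P (F.obj X) ∧ Epi (π.app X)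

section

variable [P.IsResolving]

open ZeroObject in
instance containsZero_of_isResolving : P.ContainsZero where
  exists_zero := by
    obtain ⟨Y, f, hY, _⟩ := IsResolving.exists_epi (P := P) (0 : A)
    exact ⟨0, isZero_zero A, P.prop_of_retract
      { i := 0, r := 0, retract := (isZero_zero A).eq_of_src _ _ } hY⟩

instance isClosedUnderExtensions_of_isResolving : P.IsClosedUnderExtensions where
  prop_X₂_of_shortExact hS h₁ h₃ := (IsResolving.prop_X₁_iff_prop_X₂ _ hS h₃).1 h₁

end

/-- The inclusion of an extension closed subcategory of an abelian category is exact. -/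
instance isExactFunctor_ι [P.ContainsZero] [P.IsClosedUnderIsomorphisms]
    [P.IsClosedUnderExtensions] : ExactCategory.IsExactFunctor P.ι where
  map_conflation _ hS := hS

/-- There exists an exact sequence `0 ⟶ X n ⟶ ⋯ ⟶ X 1 ⟶ X 0 ⟶ X ⟶ 0` such that all `X i` satisfy
the property `P`. -/
def HasResolutionOfLength (n : ℕ) (X : A) : Prop :=
  ∃ S : ComposableArrows A (n + 3), S.Exact ∧ IsZero (S.obj 0) ∧
    (∀ i : Fin (n + 4), 1 ≤ i.1 → i.1 ≤ n + 1 → P (S.obj i)) ∧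
    Nonempty (S.obj ⟨n + 2, by lia⟩ ≅ X) ∧ IsZero (S.obj ⟨n + 3, by lia⟩)

open Classical in
/-- The resolution dimension of an object: the least `n` such that there is a resolution of
length `n` by objects satisfying the property `P`, or `⊤` if there is no such `n`. -/
noncomputable def resolutionDimension (X : A) : ℕ∞ :=
  if h : ∃ n, P.HasResolutionOfLength n X then (Nat.find h : ℕ∞) else ⊤

end ObjectProperty

end CategoryTheory

/-! ### Syzygies: resolution dimension made independent of the chosen resolution. -/

namespace CategoryTheory

namespace ObjectProperty

variable {A : Type u} [Category.{v} A] [Abelian A]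

/-! Write `E` for the resolving subcategory given by `P`. The bound `n` is used twice: it shows that
acyclicity over `E` is the same as acyclicity over `A`, and that every unbounded complex over `A`
receives a quasi-isomorphism from a complex over `E`.

Both uses rest on dimension shifting. `SyzygyDimensionLE` quantifies over all choices of syzygies,
while a resolution provides only one. A Schanuel argument bridges the two: the pullback of two
epimorphisms onto `X` from objects of `E` surjects onto each source, and its two kernels are the two
syzygies of `X`. Condition (R1), extended to all dimensions in `syzygyDimensionLE_kernel_iff`, then
compares them.

If a complex over `E` is acyclic in `A`, each cycle object is a syzygy of the next one. The uniform
bound is thus lowered step by step to `0`, and all cycles lie in `E` (`prop_cycles_of_acyclic`). In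
the other direction, a complex is covered by a contractible complex over `E`, the kernel is resolved
by induction on the bound, and a mapping cone is taken (`exists_quasiIso_of_syzygyDimensionLE`).
Only finitely many cones occur, so no boundedness or limit argument is needed.

With these two facts, a general criterion on calculi of fractions
(`Localization.isEquivalence_of_fullyFaithful_of_resolutions`) shows that `D(E) ⥤ D(A)` is an
equivalence. For diagrams, functorial epimorphisms make the `E`-valued diagrams resolving in `A^I`.
Since kernels are computed pointwise, the syzygy bound passes to diagrams with the same `n`, and the
same argument applies to each `I`. -/

lemma isPullback_kernel_comp {X Y Z : A} (g : X ⟶ Y) (f : Y ⟶ Z) :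
    IsPullback (kernel.ι (g ≫ f)) (kernel.map (g ≫ f) f g (𝟙 Z) (by simp)) g (kernel.ι f) where
  w := by simp
  isLimit' := ⟨PullbackCone.IsLimit.mk _
    (fun s => kernel.lift _ s.fst (by rw [reassoc_of% s.condition, kernel.condition, comp_zero]))
    (fun s => by simp)
    (fun s => by
      rw [← cancel_mono (kernel.ι f)]
      simpa using s.condition)
    (fun s m h₁ h₂ => by
      rw [← cancel_mono (kernel.ι (g ≫ f))]
      simpa using h₁)⟩

/-- The property that all `n`-th syzygies of an object, computed using epimorphisms from objects
satisfying `P`, satisfy `P`. -/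
def SyzygyDimensionLE (P : ObjectProperty A) : ℕ → ObjectProperty A
  | 0 => P
  | k + 1 => fun X => ∀ ⦃Y : A⦄ (f : Y ⟶ X) [Epi f], P Y → SyzygyDimensionLE P k (kernel f)

variable (P : ObjectProperty A) [P.IsResolving]

instance isClosedUnderIsomorphisms_syzygyDimensionLE (k : ℕ) :
    (P.SyzygyDimensionLE k).IsClosedUnderIsomorphisms := by
  induction k with
  | zero => exact inferInstanceAs P.IsClosedUnderIsomorphisms
  | succ k hk =>
    refine ⟨fun {X X'} e hX Y f _ hY => ?_⟩
    exact (P.SyzygyDimensionLE k).prop_of_iso (kernelCompMono f e.inv)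
      (hX (f ≫ e.inv) hY)

variable {P}

lemma prop_kernel_iff {Y Z : A} (f : Y ⟶ Z) [Epi f] (hZ : P Z) : P (kernel f) ↔ P Y :=
  IsResolving.prop_X₁_iff_prop_X₂ (ShortComplex.mk (kernel.ι f) f (kernel.condition f))
    { exact := ShortComplex.exact_of_f_is_kernel _ (kernelIsKernel f) } hZ

lemma syzygyDimensionLE_kernel_iff_of_isPullback (k : ℕ) {W X Y Z : A} {t : W ⟶ X} {l : W ⟶ Y}
    {r : X ⟶ Z} {b : Y ⟶ Z} (sq : IsPullback t l r b) :
    P.SyzygyDimensionLE k (kernel l) ↔ P.SyzygyDimensionLE k (kernel r) :=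
  have := isIso_kernel_map_of_isPullback sq.flip
  (P.SyzygyDimensionLE k).prop_iff_of_iso (asIso (kernel.map _ _ _ _ sq.w.symm))

/-- Schanuel's argument: the projections of the pullback of `f` and `g` have kernels isomorphic to
those of `g` and `f`, and land in objects satisfying `P`. By `hk` each kernel has dimension at most
`k` exactly when the pullback does. The comparison is a hypothesis because this lemma is needed
inside the induction that proves it. -/
lemma syzygyDimensionLE_succ_of_forall_kernel_iff {k : ℕ}
    (hk : ∀ ⦃W Y : A⦄ (f : W ⟶ Y) [Epi f], P Y →
      (P.SyzygyDimensionLE k (kernel f) ↔ P.SyzygyDimensionLE k W))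
    {X Y : A} (f : Y ⟶ X) [Epi f] (hY : P Y) (hf : P.SyzygyDimensionLE k (kernel f)) :
    P.SyzygyDimensionLE (k + 1) X := by
  intro Y' g _ hY'
  have sq := IsPullback.of_hasPullback f g
  rw [← syzygyDimensionLE_kernel_iff_of_isPullback k sq, hk _ hY'] at hf
  rwa [← syzygyDimensionLE_kernel_iff_of_isPullback k sq.flip, hk _ hY]

/-- One half of (R1), carried from `P` to every dimension. An epimorphism `g : E ⟶ W` with `P E`
restricts to an epimorphism `kernel (g ≫ f) ⟶ kernel f` with the same kernel, and its source
satisfies `P` by (R1). So `W` and `kernel f` share a syzygy. -/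
lemma syzygyDimensionLE_kernel_iff (k : ℕ) {W Y : A} (f : W ⟶ Y) [Epi f] (hY : P Y) :
    P.SyzygyDimensionLE k (kernel f) ↔ P.SyzygyDimensionLE k W := by
  induction k generalizing W Y with
  | zero => exact prop_kernel_iff (P := P) f hY
  | succ k hk =>
    -- This map is the base change of `g` along `kernel.ι f`.
    have epi {E : A} (g : E ⟶ W) [Epi g] : Epi (kernel.map (g ≫ f) f g (𝟙 Y) (by simp)) :=
      Abelian.epi_snd_of_isLimit _ _ (isPullback_kernel_comp g f).isLimit
    constructor
    · intro h E g _ hE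
      have := epi g
      exact (syzygyDimensionLE_kernel_iff_of_isPullback k (isPullback_kernel_comp g f)).1
        (h (kernel.map (g ≫ f) f g (𝟙 Y) _) ((prop_kernel_iff (g ≫ f) hY).2 hE))
    · intro h
      -- One cover of `W` bounds one syzygy of `kernel f`; Schanuel's argument extends the bound to
      -- all of them.
      obtain ⟨E, g, hE, _⟩ := IsResolving.exists_epi (P := P) W
      have := epi g
      exact syzygyDimensionLE_succ_of_forall_kernel_iff (fun _ _ f h hY => hk f hY)
        (kernel.map (g ≫ f) f g (𝟙 Y) _) ((prop_kernel_iff (g ≫ f) hY).2 hE)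
        ((syzygyDimensionLE_kernel_iff_of_isPullback k (isPullback_kernel_comp g f)).2 (h g hE))

lemma syzygyDimensionLE_succ_of_kernel {k : ℕ} {X Y : A} (f : Y ⟶ X) [Epi f] (hY : P Y)
    (hf : P.SyzygyDimensionLE k (kernel f)) : P.SyzygyDimensionLE (k + 1) X :=
  syzygyDimensionLE_succ_of_forall_kernel_iff
    (fun _ _ f _ hY => syzygyDimensionLE_kernel_iff k f hY) f hY hf

lemma syzygyDimensionLE_monotone : Monotone P.SyzygyDimensionLE := by
  refine monotone_nat_of_le_succ (fun k => ?_)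
  induction k with
  | zero => exact fun X hX Y f _ hY => (prop_kernel_iff (P := P) f hX).2 hY
  | succ k hk => exact fun X hX Y f _ hY => hk _ (hX f hY)

lemma syzygyDimensionLE_X₁ {k : ℕ} {S : ShortComplex A} (hS : S.ShortExact) (h₂ : P S.X₂)
    (h₃ : P.SyzygyDimensionLE (k + 1) S.X₃) : P.SyzygyDimensionLE k S.X₁ :=
  have := hS.epi_g
  (P.SyzygyDimensionLE k).prop_of_iso
    (IsLimit.conePointUniqueUpToIso hS.fIsKernel (limit.isLimit _)).symm (h₃ S.g h₂)

/-- Exactness makes `S.X₁` surject onto `kernel S.g`, with kernel `kernel S.f`. -/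
lemma syzygyDimensionLE_kernel_of_exact {k : ℕ} {S : ShortComplex A} (hS : S.Exact)
    (h₁ : P S.X₁) (hf : P.SyzygyDimensionLE k (kernel S.f)) :
    P.SyzygyDimensionLE (k + 1) (kernel S.g) := by
  have := S.exact_iff_epi_kernel_lift.1 hS
  refine syzygyDimensionLE_succ_of_kernel (kernel.lift S.g S.f S.zero) h₁
    ((P.SyzygyDimensionLE k).prop_of_iso ?_ hf)
  exact kernelIsoOfEq (by simp) ≪≫ kernelCompMono (kernel.lift S.g S.f S.zero) (kernel.ι S.g)

lemma HasResolutionOfLength.syzygyDimensionLE {n : ℕ} {X : A} (h : P.HasResolutionOfLength n X) :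
    P.SyzygyDimensionLE n X := by
  obtain ⟨S, hS, h₀, hP, ⟨e⟩, h₁⟩ := h
  -- The shift by `2` makes the ends fit: for `i = 0` the kernel is `S.obj 1`, since `S.obj 0` is
  -- zero; for `i = n` the target `S.obj (n + 3)` is zero, so the kernel is `S.obj (n + 2)`, that
  -- is, `X`.
  have key (i : ℕ) (hi : i ≤ n) :
      P.SyzygyDimensionLE i (kernel (S.map' (i + 2) (i + 3))) := by
    induction i with
    | zero =>
      have h₁₂ : S.map' 1 2 ≫ S.map' 2 3 = 0 := hS.toIsComplex.zero 1
      have hm : Mono (S.map' 1 2) := (hS.exact 0).mono_g (h₀.eq_of_src _ _)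
      have he := (S.sc hS.toIsComplex 1).exact_iff_epi_kernel_lift.1 (hS.exact 1)
      have hm' : Mono (kernel.lift (S.map' 2 3) (S.map' 1 2) h₁₂) :=
        mono_of_mono_fac (kernel.lift_ι _ _ h₁₂)
      have hi : IsIso (kernel.lift (S.map' 2 3) (S.map' 1 2) h₁₂) := isIso_of_mono_of_epi _
      have h := hP ⟨1, by lia⟩ (by simp) (by simp)
      exact P.prop_of_iso (@asIso _ _ _ _ _ hi) h
    | succ i hk =>
      exact syzygyDimensionLE_kernel_of_exact (hS.exact (i + 2))
        (hP ⟨i + 2, by lia⟩ (by simp) (by simp; lia)) (hk (by lia))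
  refine (P.SyzygyDimensionLE n).prop_of_iso ?_ (key n le_rfl)
  exact kernelIsoOfEq (h₁.eq_of_tgt _ 0) ≪≫ kernelZeroIsoSource ≪≫ e

lemma syzygyDimensionLE_of_resolutionDimension_le {n : ℕ} {X : A}
    (h : P.resolutionDimension X ≤ n) : P.SyzygyDimensionLE n X := by
  classical
  unfold resolutionDimension at h
  split_ifs at h with h'
  · exact syzygyDimensionLE_monotone (by simpa using h) _ (Nat.find_spec h').syzygyDimensionLE
  · simp at h

end ObjectProperty

end CategoryTheory

/-! ### Resolving unbounded complexes, and cycles of acyclic complexes. -/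

namespace CategoryTheory

namespace ObjectProperty

section

variable {A : Type u} [Category.{v} A] [Abelian A]

open CochainComplex HomComplex

/-- The complex with zero differentials with given terms. -/
@[simps]
def zeroDifferentialComplex (X : ℤ → A) : CochainComplex A ℤ where
  X := X
  d _ _ := 0

variable {P : ObjectProperty A} [P.IsResolving]

lemma prop_mappingCone_X {K L : CochainComplex A ℤ} (φ : K ⟶ L) (hK : ∀ n, P (K.X n))
    (hL : ∀ n, P (L.X n)) (n : ℤ) : P ((mappingCone φ).X n) :=
  P.prop_of_iso (HomologicalComplex.homotopyCofiber.XIsoBiprod φ n (n + 1) rfl).symm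
    (P.prop_biprod (hK _) (hL _))

-- The covering complex is a direct sum of discs: a degreewise cover `F n ⟶ M.X n` extends uniquely
-- to a chain map from the disc on `F n` in degrees `n` and `n + 1`.
variable (P) in
lemma exists_epi_cochainComplex (M : CochainComplex A ℤ) :
    ∃ (K : CochainComplex A ℤ) (f : K ⟶ M), (∀ n, P (K.X n)) ∧ Epi f := by
  choose F p hF hp using fun n : ℤ => IsResolving.exists_epi (P := P) (M.X n)
  -- The shift by one puts `F n` in degree `n` of the cone of `𝟙 K`, whose degree `n` term is `K.X
  -- (n + 1) ⊞ K.X n`.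
  let K := zeroDifferentialComplex (fun n => F (n - 1))
  let α : Cochain K M (-1) := Cochain.mk (fun i j hij =>
    (eqToHom (congrArg F (by lia)) : K.X i ⟶ F j) ≫ p j)
  -- The coboundary of `α` is the only chain map that `α` exhibits as null-homotopic, as needed to
  -- descend to the cone.
  let β : K ⟶ M := (Cocycle.mk (δ (-1) 0 α) 1 (by simp) (δ_δ _ _ _ α)).homOf
  refine ⟨mappingCone (𝟙 K), mappingCone.desc (𝟙 K) α β (by simp [β]),
    prop_mappingCone_X _ (fun n => hF _) (fun n => hF _), ?_⟩
  refine HomologicalComplex.epi_of_epi_f _ (fun n => ?_)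
  -- On the summand `K.X (n + 1)` the map is `p n` up to transport, which is already epi.
  have h := mappingCone.inl_v_desc_f (𝟙 K) α β (by simp [β]) (n + 1) n (by lia)
  have : Epi (α.v (n + 1) n (by lia)) := by
    have : Epi (eqToHom (congrArg F (show n + 1 - 1 = n by lia))) := inferInstance
    exact epi_comp' this (hp n)
  exact epi_of_epi_fac h

/-- In the derived category, a morphism of distinguished triangles that is invertible on two
vertices is invertible on the third. -/
lemma quasiIso_mappingCone_map {K L M : CochainComplex A ℤ} (s : K ⟶ L) [QuasiIso s]
    (f : L ⟶ M) : QuasiIso (mappingCone.map (s ≫ f) f s (𝟙 M) (by simp)) := by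
  let := HasDerivedCategory.standard A
  rw [← DerivedCategory.isIso_Q_map_iff_quasiIso]
  refine Pretriangulated.isIso₃_of_isIso₁₂
    (DerivedCategory.Q.mapTriangle.map (mappingCone.triangleMap (s ≫ f) f s (𝟙 M) (by simp)))
    (DerivedCategory.mappingCone_triangle_distinguished _)
    (DerivedCategory.mappingCone_triangle_distinguished _) ?_ ?_
  · exact inferInstanceAs (IsIso (DerivedCategory.Q.map s))
  · exact inferInstanceAs (IsIso (DerivedCategory.Q.map (𝟙 M)))

lemma exists_quasiIso_of_syzygyDimensionLE {k : ℕ} (M : CochainComplex A ℤ)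
    (hM : ∀ n, P.SyzygyDimensionLE k (M.X n)) :
    ∃ (K : CochainComplex A ℤ) (s : K ⟶ M), (∀ n, P (K.X n)) ∧ QuasiIso s := by
  induction k generalizing M with
  | zero => exact ⟨M, 𝟙 M, hM, inferInstance⟩
  | succ k hk =>
    obtain ⟨L, f, hL, _⟩ := exists_epi_cochainComplex P M
    let S := ShortComplex.mk (kernel.ι f) f (kernel.condition f)
    have hS : S.ShortExact := { exact := ShortComplex.exact_of_f_is_kernel _ (kernelIsKernel f) }
    obtain ⟨K, s, hK, _⟩ := hk (kernel f) (fun n => syzygyDimensionLE_X₁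
      ((HomologicalComplex.shortExact_iff_degreewise_shortExact _).1 hS n) (hL n) (hM n))
    have := quasiIso_mappingCone_map s S.f
    have := mappingCone.quasiIso_descShortComplex hS
    -- Replacing `kernel f` by its resolution `K` does not change the cone of `kernel f ⟶ L` up to
    -- quasi-isomorphism, and that cone is quasi-isomorphic to `M`.
    exact ⟨mappingCone (s ≫ S.f), mappingCone.map (s ≫ S.f) S.f s (𝟙 _) (by simp) ≫
      mappingCone.descShortComplex S, prop_mappingCone_X _ hK hL, inferInstance⟩

lemma shortExact_cycles {K : CochainComplex A ℤ} (hK : K.Acyclic) (n : ℤ) :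
    (ShortComplex.mk (K.iCycles n) (K.toCycles n (n + 1)) (by
      rw [← cancel_mono (K.iCycles (n + 1))]; simp)).ShortExact where
  exact := by
    let φ : ShortComplex.mk (K.iCycles n) (K.toCycles n (n + 1)) (by
        rw [← cancel_mono (K.iCycles (n + 1))]; simp) ⟶
        ShortComplex.mk (K.iCycles n) (K.d n (n + 1)) (by simp) :=
      { τ₁ := 𝟙 _, τ₂ := 𝟙 _, τ₃ := K.iCycles (n + 1) }
    have : Epi φ.τ₁ := inferInstanceAs (Epi (𝟙 _))
    have : IsIso φ.τ₂ := inferInstanceAs (IsIso (𝟙 _))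
    have : Mono φ.τ₃ := inferInstanceAs (Mono (K.iCycles (n + 1)))
    rw [ShortComplex.exact_iff_of_epi_of_isIso_of_mono φ]
    exact ShortComplex.exact_of_f_is_kernel _ (K.cyclesIsKernel n (n + 1) (by simp))
  mono_f := inferInstanceAs (Mono (K.iCycles n))
  epi_g := Preadditive.epi_of_isZero_cokernel' _ (K.homologyIsCokernel n (n + 1) (by simp))
    (hK (n + 1)).isZero_homology

/-- Each cycle object is a syzygy of the next one, so a bound valid in all degrees at once can be
lowered by one in all degrees at once. -/
lemma prop_cycles_of_acyclic {k : ℕ} {K : CochainComplex A ℤ} (hK : K.Acyclic)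
    (hP : ∀ n, P (K.X n)) (hk : ∀ n, P.SyzygyDimensionLE k (K.cycles n)) (n : ℤ) :
    P (K.cycles n) := by
  induction k generalizing n with
  | zero => exact hk n
  | succ k h => exact h (fun n => syzygyDimensionLE_X₁ (shortExact_cycles hK n) (hP n) (hk _)) n

end

/-! ### Passage to diagram categories. -/

section

/-- The diagrams whose values satisfy a property of objects. -/
def diagrams {A : Type u} [Category.{v} A] (P : ObjectProperty A) (I : Type w)
    [Category.{w'} I] : ObjectProperty (I ⥤ A) :=
  fun X => ∀ i, P (X.obj i)

variable {A : Type u} [Category.{v} A] [Abelian A] (P : ObjectProperty A)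
variable (I : Type w) [Category.{w'} I]

/-- Retracts and short exact sequences are handled pointwise. Only the existence of covers needs
functoriality: `X` is covered by its composite with the resolving functor. -/
instance isResolving_diagrams [P.IsFunctoriallyResolving] : (P.diagrams I).IsResolving where
  of_retract r h i := P.prop_of_retract (r.map ((evaluation I A).obj i)) (h i)
  prop_X₁_iff_prop_X₂ S hS h₃ :=
    forall_congr' (fun i => IsResolving.prop_X₁_iff_prop_X₂ _
      (hS.map_of_exact ((evaluation I A).obj i)) (h₃ i))
  exists_epi X := by
    obtain ⟨F, π, h⟩ := IsFunctoriallyResolving.exists_functor (P := P)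
    have (i : I) : Epi ((Functor.whiskerLeft X π).app i) := (h _).2
    exact ⟨X ⋙ F, Functor.whiskerLeft X π ≫ (Functor.rightUnitor X).hom, fun i => (h _).1,
      epi_comp' (NatTrans.epi_of_epi_app _) inferInstance⟩

/-- Evaluation preserves kernels, so a syzygy of a diagram is pointwise a syzygy. Because the bound
holds for all choices of syzygies, no compatible family of resolutions has to be found. -/
lemma syzygyDimensionLE_diagrams [P.IsResolving] {k : ℕ} {X : I ⥤ A}
    (hX : ∀ i, P.SyzygyDimensionLE k (X.obj i)) : (P.diagrams I).SyzygyDimensionLE k X := by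
  induction k generalizing X with
  | zero => exact hX
  | succ k hk =>
    refine fun Y f _ hY => hk (fun i => ?_)
    exact (P.SyzygyDimensionLE k).prop_of_iso
      (PreservesKernel.iso ((evaluation I A).obj i) f).symm (hX i (f.app i) (hY i))

end

end ObjectProperty

end CategoryTheory

/-! ### A criterion for a functor between localizations to be an equivalence. -/

namespace CategoryTheory

section

variable {C₁ C₂ D₁ D₂ : Type*} [Category* C₁] [Category* C₂] [Category* D₁] [Category* D₂]

/-- A fully faithful functor such that any object of the target admits a resolution by an object
of the source induces an equivalence between localized categories. -/
lemma Localization.isEquivalence_of_fullyFaithful_of_resolutions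
    (Φ : C₁ ⥤ C₂) [Φ.Full] [Φ.Faithful]
    (W₁ : MorphismProperty C₁) (W₂ : MorphismProperty C₂) [W₁.HasLeftCalculusOfFractions]
    [W₂.HasRightCalculusOfFractions] (hW : W₁ = W₂.inverseImage Φ)
    (hΦ : ∀ Y : C₂, ∃ (X : C₁) (s : Φ.obj X ⟶ Y), W₂ s)
    (L₁ : C₁ ⥤ D₁) (L₂ : C₂ ⥤ D₂) [L₁.IsLocalization W₁] [L₂.IsLocalization W₂]
    (F : D₁ ⥤ D₂) (e : L₁ ⋙ F ≅ Φ ⋙ L₂) : F.IsEquivalence := by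
  have := Localization.essSurj L₁ W₁
  have := Localization.essSurj L₂ W₂
  have isIso_map {X Y : C₁} (s : X ⟶ Y) (hs : W₂ (Φ.map s)) : IsIso (L₁.map s) :=
    Localization.inverts L₁ W₁ s (by rwa [hW])
  have isIso_map₂ {X Y : C₂} (s : X ⟶ Y) (hs : W₂ s) : IsIso (L₂.map s) :=
    Localization.inverts L₂ W₂ s hs
  -- A denominator over an object of `C₁` can be refined to one coming from `C₁`, which `L₁` then
  -- inverts. Faithfulness and fullness both reduce to this.
  have refine_source {X : C₁} {M : C₂} (s : M ⟶ Φ.obj X) (hs : W₂ s) :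
      ∃ (X' : C₁) (t : Φ.obj X' ⟶ M) (s' : X' ⟶ X), Φ.map s' = t ≫ s ∧ W₂ t ∧
        IsIso (L₁.map s') := by
    obtain ⟨X', t, ht⟩ := hΦ M
    obtain ⟨s', hs'⟩ := Φ.map_surjective (t ≫ s)
    exact ⟨X', t, s', hs', ht, isIso_map s' (by rw [hs']; exact W₂.comp_mem _ _ ht hs)⟩
  have naturality {X Y : C₁} (f : X ⟶ Y) :
      F.map (L₁.map f) ≫ e.hom.app Y = e.hom.app X ≫ L₂.map (Φ.map f) := e.hom.naturality f
  have : F.Faithful := by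
    refine Functor.faithful_of_comp_of_hasLeftCalculusOfFractions L₁ W₁ F (fun X Y f g h => ?_)
    have h' : L₂.map (Φ.map f) = L₂.map (Φ.map g) := by
      rw [← cancel_epi (e.hom.app X), ← naturality, ← naturality, h]
    obtain ⟨M, s, hs, eq⟩ := (MorphismProperty.map_eq_iff_precomp L₂ W₂ _ _).1 h'
    obtain ⟨X', t, s', hs', ht, _⟩ := refine_source s hs
    rw [← cancel_epi (L₁.map s'), ← L₁.map_comp, ← L₁.map_comp]
    congr 1
    apply Φ.map_injective
    simp [hs', eq]
  have : F.Full := by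
    refine F.full_of_comp_essSurj L₁ (fun X Y φ => ?_)
    -- The given morphism, seen in `D₂` between objects from `C₁`, is a right fraction; after
    -- refining its apex, fullness of `Φ` lifts both legs.
    obtain ⟨ψ, hψ⟩ := Localization.exists_rightFraction L₂ W₂
      (e.inv.app X ≫ φ ≫ e.hom.app Y)
    obtain ⟨X', t, s', hs', ht, _⟩ := refine_source ψ.s ψ.hs
    obtain ⟨f, hf⟩ := Φ.map_surjective (t ≫ ψ.f)
    refine ⟨inv (L₁.map s') ≫ L₁.map f, ?_⟩
    have h : F.map (L₁.map s') ≫ φ = F.map (L₁.map f) := by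
      rw [← cancel_mono (e.hom.app Y), naturality, hf, L₂.map_comp,
        ← ψ.map_s_comp_map L₂ (Localization.inverts L₂ W₂), ← hψ, ← L₂.map_comp_assoc, ← hs',
        ← reassoc_of% (naturality s')]
      simp
    rw [F.map_comp, ← h, ← F.map_comp_assoc, IsIso.inv_hom_id, F.map_id, Category.id_comp]
  have : F.EssSurj := by
    refine ⟨fun Z => ?_⟩
    obtain ⟨X, s, hs⟩ := hΦ (L₂.objPreimage Z)
    have := isIso_map₂ s hs
    exact ⟨L₁.obj X, ⟨e.app X ≪≫ asIso (L₂.map s) ≪≫ L₂.objObjPreimageIso Z⟩⟩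
  exact { }

end

end CategoryTheory

/-! ### Comparison of `D(E)` and `D(A)` for a fully faithful exact functor. -/

namespace CategoryTheory

lemma Functor.exists_iso_mapHomologicalComplex_obj {E A : Type*} [Category* E] [Category* A]
    [Preadditive E] [Preadditive A] (G : E ⥤ A) [G.Additive] [G.Full] [G.Faithful]
    {ι : Type*} {c : ComplexShape ι} (K : HomologicalComplex A c)
    (hK : ∀ i, G.essImage (K.X i)) :
    ∃ (L : HomologicalComplex E c), Nonempty ((G.mapHomologicalComplex c).obj L ≅ K) := by
  choose X e using hK
  replace e (i : ι) : G.obj (X i) ≅ K.X i := (e i).some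
  choose d hd using fun i j => G.map_surjective ((e i).hom ≫ K.d i j ≫ (e j).inv)
  let L : HomologicalComplex E c :=
    { X := X
      d := d
      shape i j hij := G.map_injective (by simp [hd, K.shape i j hij])
      d_comp_d' i j k _ _ := G.map_injective (by simp [hd]) }
  exact ⟨L, ⟨HomologicalComplex.Hom.isoOfComponents e (fun i j _ => by
    change (e i).hom ≫ K.d i j = G.map (d i j) ≫ (e j).hom
    simp [hd])⟩⟩

namespace ExactCategory

variable {E : Type u} [Category.{v} E] [Preadditive E] [HasZeroObject E] [HasBinaryBiproducts E]
  [ExactCategory E] {A : Type u'} [Category.{v'} A] [Abelian A]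

section

variable (G : E ⥤ A) [IsExactFunctor G] [G.Full] [G.Faithful]
  (hG : ∀ S : ShortComplex E, (S.map G).ShortExact → conflation S)

include hG

lemma isAcyclic_of_prop_cycles (K : CochainComplex E ℤ)
    (hK : ((G.mapHomologicalComplex _).obj K).Acyclic)
    (hZ : ∀ n, G.essImage (((G.mapHomologicalComplex _).obj K).cycles n)) : IsAcyclic K := by
  -- From here on, only the factorisation of the differential and the short exactness matter, not
  -- that the `W n` are cycles.
  obtain ⟨W, ι, π, w, hW, fac, hS⟩ : ∃ (W : ℤ → A) (ι : ∀ n, W n ⟶ G.obj (K.X n))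
      (π : ∀ n, G.obj (K.X n) ⟶ W (n + 1)) (w : ∀ n, ι n ≫ π n = 0), (∀ n, G.essImage (W n)) ∧
      (∀ n, π n ≫ ι (n + 1) = G.map (K.d n (n + 1))) ∧
      ∀ n, (ShortComplex.mk (ι n) (π n) (w n)).ShortExact :=
    ⟨_, _, _, _, hZ, fun n => HomologicalComplex.toCycles_i _ _ _,
      fun n => ObjectProperty.shortExact_cycles hK n⟩
  choose Z e using hW
  replace e (n : ℤ) : G.obj (Z n) ≅ W n := (e n).some
  choose i hi using fun n => G.map_surjective ((e n).hom ≫ ι n)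
  choose p hp using fun n => G.map_surjective (π n ≫ (e (n + 1)).inv)
  refine ⟨Z, i, p, fun n => G.map_injective ?_, fun n => G.map_injective ?_, fun n => hG _ ?_⟩
  · simp [hi, hp, reassoc_of% w]
  · simp [hi, hp, fac]
  · refine ShortComplex.shortExact_of_iso (S₁ := ShortComplex.mk (ι n) (π n) (w n))
      (ShortComplex.isoMk (e n).symm (Iso.refl _) (e (n + 1)).symm ?_ ?_) (hS n)
    · change (e n).inv ≫ G.map (i n) = ι n ≫ 𝟙 _
      simp [hi]
    · change 𝟙 _ ≫ G.map (p n) = π n ≫ (e (n + 1)).inv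
      simp [hp]

variable {P : ObjectProperty A} [P.IsResolving] (hP : G.essImage = P) {n : ℕ}
  (hn : ∀ X, P.SyzygyDimensionLE n X)

include hP hn

lemma acyclic_iff (K : HomotopyCategory E (ComplexShape.up ℤ)) :
    acyclic E K ↔ HomotopyCategory.subcategoryAcyclic A
      ((G.mapHomotopyCategory (ComplexShape.up ℤ)).obj K) := by
  refine ⟨mapHomotopyCategory_acyclic G, fun hK => ?_⟩
  replace hK := (HomotopyCategory.quotient_obj_mem_subcategoryAcyclic_iff_acyclic
    ((G.mapHomologicalComplex _).obj K.as)).1 hK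
  refine isAcyclic_of_prop_cycles G hG _ hK (fun k => ?_)
  rw [hP]
  exact ObjectProperty.prop_cycles_of_acyclic hK
    (fun m => by rw [← hP]; exact G.obj_mem_essImage _) (fun _ => hn _) k

/-- For the nontrivial inclusion, a cone that becomes acyclic in `A` is already acyclic over `E`. It
therefore lies in the thick envelope, which never has to be described explicitly. -/
lemma quasiIso_eq_inverseImage :
    quasiIso E = (HomotopyCategory.quasiIso A (ComplexShape.up ℤ)).inverseImage
      (G.mapHomotopyCategory (ComplexShape.up ℤ)) := by
  refine le_antisymm (quasiIso_le G) ?_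
  rw [HomotopyCategory.quasiIso_eq_trW_subcategoryAcyclic]
  intro K L f hf
  refine ObjectProperty.trW_monotone (fun M hM => ObjectProperty.le_triangEnvelope _ _ ?_) _
    ((ObjectProperty.inverseImage_trW_iff _ _ _).2 hf)
  exact (acyclic_iff G hG hP hn M).2 hM

/-- Formulated for a functor with essential image `P`, not for an inclusion, so that it also covers
`E^I ⥤ A^I`, whose source is not literally a full subcategory of `A^I`. -/
lemma isEquivalence_derivedFunctor [HasDerivedCategory.{w} A] :
    (derivedFunctor G).IsEquivalence := by
  refine Localization.isEquivalence_of_fullyFaithful_of_resolutions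
    (G.mapHomotopyCategory (ComplexShape.up ℤ)) (quasiIso E)
    (HomotopyCategory.subcategoryAcyclic A).trW ?_ ?_
    (Derived.Qh E) DerivedCategory.Qh (derivedFunctor G)
    (Localization.Lifting.iso _ (quasiIso E) _ _)
  · rw [quasiIso_eq_inverseImage G hG hP hn,
      HomotopyCategory.quasiIso_eq_trW_subcategoryAcyclic]
  · intro Y
    obtain ⟨M, rfl⟩ := HomotopyCategory.quotient_obj_surjective Y
    obtain ⟨K, s, hK, _⟩ := ObjectProperty.exists_quasiIso_of_syzygyDimensionLE M
      (fun i => hn (M.X i))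
    obtain ⟨L, ⟨e⟩⟩ := G.exists_iso_mapHomologicalComplex_obj K (by rwa [hP])
    refine ⟨(HomotopyCategory.quotient _ _).obj L,
      (HomotopyCategory.quotient _ _).map (e.hom ≫ s), ?_⟩
    rw [← HomotopyCategory.quasiIso_eq_trW_subcategoryAcyclic]
    refine (HomotopyCategory.quotient_map_mem_quasiIso_iff (e.hom ≫ s)).2 ?_
    rw [HomologicalComplex.mem_quasiIso_iff]
    infer_instance

end

/-- Every arrow of `D(E)` is isomorphic to one from `K(E)`, so it suffices that the composite with
the quotient functor is triangulated. That composite is isomorphic, compatibly with shifts, to a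
triangulated functor. -/
instance isTriangulated_derivedFunctor (G : E ⥤ A) [IsExactFunctor G] [HasDerivedCategory.{w} A] :
    (derivedFunctor G).IsTriangulated := by
  have : (Derived.Qh E).mapArrow.EssSurj := Localization.essSurj_mapArrow _ (quasiIso E)
  let e : Derived.Qh E ⋙ derivedFunctor G ≅
      G.mapHomotopyCategory (ComplexShape.up ℤ) ⋙ DerivedCategory.Qh :=
    Localization.Lifting.iso _ (quasiIso E) _ _
  have : NatTrans.CommShift e.hom ℤ :=
    NatTrans.commShift_iso_hom_of_localization (Derived.Qh E) (quasiIso E) ℤ _ _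
  exact Functor.isTriangulated_of_precomp_iso e

end ExactCategory

/-! ### Essential images of the two inclusions, and the conclusion. -/

namespace ObjectProperty

variable {A : Type u} [Category.{v} A] (P : ObjectProperty A) [P.IsClosedUnderIsomorphisms]

lemma essImage_ι_eq : P.ι.essImage = P := by
  ext X
  constructor
  · rintro ⟨Y, ⟨e⟩⟩
    exact P.prop_of_iso e Y.property
  · exact fun hX => P.ι.obj_mem_essImage ⟨X, hX⟩

lemma essImage_whiskeringRight_obj_ι (I : Type w) [Category.{w'} I] :
    ((Functor.whiskeringRight I P.FullSubcategory A).obj P.ι).essImage = P.diagrams I := by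
  ext X
  constructor
  · rintro ⟨Y, ⟨e⟩⟩ i
    exact P.prop_of_iso (e.app i) (Y.obj i).property
  · intro hX
    exact ⟨P.lift X hX, ⟨P.liftCompιIso X hX⟩⟩

end ObjectProperty

end CategoryTheory

theorem proposition4 {A : Type u} [Category.{v} A] [Abelian A] [HasDerivedCategory.{w'} A]
    (P : ObjectProperty A) [P.IsResolving]
    (n : ℕ) (hn : ∀ X : A, P.resolutionDimension X ≤ n) :
    ((ExactCategory.derivedFunctor P.ι).IsTriangulated ∧
      (ExactCategory.derivedFunctor P.ι).IsEquivalence) ∧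
    (P.IsFunctoriallyResolving →
      (ExactCategory.prederivatorMap.{w} P.ι).IsComponentwiseEquivalence) := by
  have hn' (X : A) : P.SyzygyDimensionLE n X :=
    ObjectProperty.syzygyDimensionLE_of_resolutionDimension_le (hn X)
  refine ⟨⟨inferInstance, ExactCategory.isEquivalence_derivedFunctor P.ι (fun _ hS => hS)
    P.essImage_ι_eq hn'⟩, fun _ I => ?_⟩
  -- The prederivator of `A` is built from this model of the derived category.
  let := HasDerivedCategory.standard (I.unop ⥤ A)
  exact ExactCategory.isEquivalence_derivedFunctor
    ((Functor.whiskeringRight I.unop P.FullSubcategory A).obj P.ι)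
    (fun S hS i => hS.map_of_exact ((evaluation I.unop A).obj i))
    (P.essImage_whiskeringRight_obj_ι I.unop)
    (fun X => P.syzygyDimensionLE_diagrams I.unop (fun i => hn' (X.obj i)))
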